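/- Let $G=(V,E)$ be a finite connected planar graph embedded in the plane, and let $J=(J_e)_{e\in E}$ be arbitrary real coupling constants. Let $(\sigma,\tilde\sigma)\in\{-1,1\}^V\times\{-1,1\}^V$ be distributed according to the Ashkin–Teller model with free boundary conditions and $U=0$, i.e. with probability proportional to $\prod_{uv\in E}\exp\big(J_{uv}(\sigma_u\sigma_v+\tilde\sigma_u\tilde\sigma_v)\big)$ (two independent Ising models), and write $\langle\cdot\rangle$ for the expectation. Put $\varphi_v=(\sigma_v+\tilde\sigma_v)/2$ and $\tilde\varphi_v=(\sigma_v-\tilde\sigma_v)/2$, and for a set $X$ of vertices $\varphi_X=\prod_{v\in X}\varphi_v$, $\varphi^2_X=\prod_{v\in X}\varphi_v^2$, and likewise for $\tilde\varphi$. Let $A_1,A_2,B_1,B_2\subseteq V$ be pairwise disjoint sets of vertices that lie on the outer face of $G$. Let $\mathcal N$ be the set of nodes obtained from $A_1\cup A_2\cup B_1\cup B_2$ by replacing each vertex $v\in A_2\cup B_2$ by two copies $v^<,v^>$. List the nodes as $v_1,v_2,\dots,v_{|\mathcal N|}$ in a counterclockwise order along the boundary of the outer face, where $v^>$ comes immediately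 after $v^<$ for each doubled $v$. Call a node blue if it comes from $B_1\cup B_2$ and red if it comes from $A_1\cup A_2$. Let $\mathcal S_+$ (sources) be the set of nodes that are blue with odd index or red with even index, and $\mathcal S_-=\mathcal N\setminus\mathcal S_+$ (sinks). Let $K^{\mathcal S_+,\mathcal S_-}$ be the matrix with rows indexed by $\mathcal S_+$ and columns indexed by $\mathcal S_-$, both in the order of the nodes, and entries $$K^{\mathcal S_+,\mathcal S_-}_{u,v}=(-1)^{s(u,v)}\langle\sigma_u\sigma_v\rangle,\qquad u\in\mathcal S_+,\ v\in\mathcal S_-,$$ where $s(u,v)$ is the number of sources strictly between $u$ and $v$ in the order of the nodes, and $\sigma_{v^<}=\sigma_{v^>}=\sigma_v$ for doubled vertices. Then $$\langle\varphi_{A_1}\varphi^2_{A_2}\tilde\varphi_{B_1}\tilde\varphi^2_{B_2}\rangle=\begin{cases}2^{-|\mathcal N|/2}\det\big(K^{\mathcal S_+,\mathcal S_-}\big)&\text{if }|\mathcal S_+|=|\mathcal S_-|,\\0&\text{otherwise.}\end{cases}$$ In particular, if $J_e\ge 0$ for all $e\in E$ and $|\mathcal S_+|=|\mathcal S_-|$,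 then $\det\big(K^{\mathcal S_+,\mathcal S_-}\big)\ge 0$. -/

import Mathlib

open scoped BigOperators

noncomputable section

/-! ### Finite graphs drawn in the plane -/

/-- A drawing of a finite graph in the plane `ℂ` without crossings: vertices are distinct points,
edges are simple arcs between their end-vertices, the relative interior of an arc contains no vertex
and no point of another arc. -/
structure PlaneEmbedding {V : Type*} (G : SimpleGraph V) where
  /-- the position of a vertex -/
  pos : V → ℂ
  /-- the (parametrised) arc that represents an edge -/
  arc : G.edgeSet → unitInterval → ℂ
  pos_injective : Function.Injective pos
  arc_continuous : ∀ e, Continuous (arc e)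
  arc_injective : ∀ e, Function.Injective (arc e)
  arc_endpoints : ∀ e : G.edgeSet, ∃ u v : V, (e : Sym2 V) = s(u, v) ∧ arc e 0 = pos u ∧ arc e 1 = pos v
  arc_avoids_vertices : ∀ e (t : unitInterval), 0 < t → t < 1 → arc e t ∉ Set.range pos
  arc_avoids_arcs : ∀ e e', e ≠ e' → ∀ t : unitInterval, 0 < t → t < 1 → arc e t ∉ Set.range (arc e')

namespace PlaneEmbedding

variable {V : Type*} {G : SimpleGraph V}

/-- The subset of the plane covered by the drawing. -/
def support (Γ : PlaneEmbedding G) : Set ℂ :=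
  Set.range Γ.pos ∪ ⋃ e, Set.range (Γ.arc e)

/-- The outer face: the unbounded connected component of the complement of the drawing. -/
def outerFace (Γ : PlaneEmbedding G) : Set ℂ :=
  {z | z ∈ Γ.supportᶜ ∧ ¬ Bornology.IsBounded (connectedComponentIn Γ.supportᶜ z)}

/-- The vertices `w 0, …, w (k - 1)` are distinct, lie on the outer face, and are listed in a
counterclockwise order along its boundary: they can be joined by pairwise disjoint curves, which run
in the outer face except for their starting points, to points of a large circle around the drawing,
and these points of the circle are in counterclockwise order. -/
def IsCounterclockwise (Γ : PlaneEmbedding G) {k : ℕ} (w : Fin k → V) : Prop :=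
  ∃ (R : ℝ) (γ : Fin k → unitInterval → ℂ) (θ : Fin k → ℝ),
    Γ.support ⊆ Metric.ball 0 R ∧
    (∀ i, Continuous (γ i)) ∧
    (∀ i, γ i 0 = Γ.pos (w i)) ∧
    (∀ i t, 0 < t → γ i t ∈ Γ.outerFace) ∧
    (∀ i t, γ i t ∈ Metric.closedBall (0 : ℂ) R) ∧
    (∀ i j, i ≠ j → Disjoint (Set.range (γ i)) (Set.range (γ j))) ∧
    (∀ i, γ i 1 = (R : ℂ) * Complex.exp ((θ i : ℂ) * Complex.I)) ∧
    StrictMono θ ∧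
    (∀ i j, θ i < θ j + 2 * Real.pi)

end PlaneEmbedding

/-! ### The Ashkin–Teller model -/

namespace AshkinTeller

/-- A `±1`-valued spin configuration. -/
abbrev Spins (V : Type*) := V → ℤˣ

section Model

variable {V : Type*}

/-- The spin at a vertex, as a real number. -/
def spin (s : Spins V) (v : V) : ℝ := ((s v : ℤ) : ℝ)

/-- The product of the two spins at the ends of an edge. -/
def edgeSpin (s : Spins V) (e : Sym2 V) : ℝ := (e.map (spin s)).mul

variable [Fintype V] [DecidableEq V] (G : SimpleGraph V) [DecidableRel G.Adj] (J U : Sym2 V → ℝ)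

/-- The unnormalised Ashkin–Teller weight of a pair of spin configurations. -/
def weight (s s' : Spins V) : ℝ :=
  ∏ e ∈ G.edgeFinset,
    Real.exp (J e * (edgeSpin s e + edgeSpin s' e) + U e * (edgeSpin s e * edgeSpin s' e + 1))

/-- The partition function. -/
def partitionFunction : ℝ := ∑ s : Spins V, ∑ s' : Spins V, weight G J U s s'

/-- The expectation of an observable in the Ashkin–Teller model with free boundary conditions. -/
def expect (F : Spins V → Spins V → ℝ) : ℝ :=
  ∑ s : Spins V, ∑ s' : Spins V, F s s' * (weight G J U s s' / partitionFunction G J U)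

/-- The two-point function `⟨σ_u σ_v⟩`. -/
def twoPoint (u v : V) : ℝ := expect G J U fun s _ => spin s u * spin s v

/-- `φ_v = (σ_v + σ̃_v) / 2`. -/
def phi (s s' : Spins V) (v : V) : ℝ := (spin s v + spin s' v) / 2

/-- `φ̃_v = (σ_v - σ̃_v) / 2`. -/
def phiTilde (s s' : Spins V) (v : V) : ℝ := (spin s v - spin s' v) / 2

/-- The correlation `⟨φ_{A₁} φ²_{A₂} φ̃_{B₁} φ̃²_{B₂}⟩`. -/
def phiCorrelation (A₁ A₂ B₁ B₂ : Finset V) : ℝ :=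
  expect G J U fun s s' =>
    (∏ v ∈ A₁, phi s s' v) * (∏ v ∈ A₂, phi s s' v ^ 2) *
      (∏ v ∈ B₁, phiTilde s s' v) * (∏ v ∈ B₂, phiTilde s s' v ^ 2)

end Model

/-! ### Nodes, sources and sinks -/

section Nodes

variable {V : Type*} [DecidableEq V] {k : ℕ}

/-- The vertex `w p.1` below the potential node `p`; lexicographically ordered pairs are used, so that
the copies `v^< = (i, 0)` and `v^> = (i, 1)` of `v = w i` are consecutive. -/
def nodeVertex (w : Fin k → V) (p : Fin k ×ₗ Fin 2) : V := w (ofLex p).1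

/-- The set of nodes: each listed vertex once, and those in `D` (the doubled vertices) twice. -/
def nodes (w : Fin k → V) (D : Finset V) : Finset (Fin k ×ₗ Fin 2) :=
  {p | (ofLex p).2 = 1 → nodeVertex w p ∈ D}

/-- The index `1, 2, 3, …` of a node in the order of the nodes. -/
def nodeIndex (N : Finset (Fin k ×ₗ Fin 2)) (p : Fin k ×ₗ Fin 2) : ℕ := {q ∈ N | q ≤ p}.card

/-- The sources: odd blue nodes and even red nodes, where the blue nodes are those over `B`. -/
def sources (w : Fin k → V) (D B : Finset V) : Finset (Fin k ×ₗ Fin 2) :=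
  {p ∈ nodes w D | (Odd (nodeIndex (nodes w D) p) ∧ nodeVertex w p ∈ B) ∨
    (Even (nodeIndex (nodes w D) p) ∧ nodeVertex w p ∉ B)}

/-- The sinks: even blue nodes and odd red nodes. -/
def sinks (w : Fin k → V) (D B : Finset V) : Finset (Fin k ×ₗ Fin 2) :=
  {p ∈ nodes w D | (Even (nodeIndex (nodes w D) p) ∧ nodeVertex w p ∈ B) ∨
    (Odd (nodeIndex (nodes w D) p) ∧ nodeVertex w p ∉ B)}

/-- The number of elements of `S` strictly between `p` and `q`. -/
def countBetween (S : Finset (Fin k ×ₗ Fin 2)) (p q : Fin k ×ₗ Fin 2) : ℕ :=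
  {r ∈ S | min p q < r ∧ r < max p q}.card

variable [Fintype V] (G : SimpleGraph V) [DecidableRel G.Adj] (J U : Sym2 V → ℝ)

/-- The signed matrix of two-point functions, with rows indexed by the sources and columns indexed by
the sinks. -/
def boundaryMatrix (w : Fin k → V) (D B : Finset V) :
    Matrix (sources w D B) (sinks w D B) ℝ :=
  fun p q => (-1) ^ countBetween (sources w D B) p q *
    twoPoint G J U (nodeVertex w p) (nodeVertex w q)

/-- The determinant of the matrix above in the balanced case; the rows and the columns are listed in
the order of the nodes. -/
def boundaryDet (w : Fin k → V) (D B : Finset V)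
    (h : (sources w D B).card = (sinks w D B).card) : ℝ :=
  ((boundaryMatrix G J U w D B).submatrix
    ((sources w D B).orderIsoOfFin rfl) ((sinks w D B).orderIsoOfFin h.symm)).det

end Nodes

end AshkinTeller

end

/-! Each `phi` or `phiTilde` is half the sum or difference of two independent spins. Expanding the
product over the nodes turns the correlation into a signed sum, over subsets `S` of the nodes, of
the Ising correlation of `S` times that of its complement (`expect_prod_nodes_eq_splitSum`).

Boundary correlations of the planar Ising model obey the Pfaffian recursion
(`isPfaffianFunction_of_isNoncrossing`). To see this, replace `(s, s')` by `(s, t)` with `t = s *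
s'`. For fixed `t` the joint weight is an Ising weight in `s` with couplings `J e * (1 + edgeSpin t
e)`. Its high-temperature expansion uses only edges across which `t` agrees, and summing over `s`
leaves only edge sets whose components each contain an even number of the nodes. These components
partition the nodes without crossings and `t` is constant on each, so the alternating sum of `t`
over the nodes vanishes (`alternating_sum_eq_zero_of_noncrossing`). Multiplying by `t` at the first
node and returning to `s` and `s'` gives the recursion. The absence of crossings is plane topology:
paths in a disc with interlaced ends meet (`exists_eq_of_interlaced`), by a winding number.

Inserting the recursion into the split sum pairs the first node `u` with some `v`. When the signs
are twisted by the parity of the index, the two ways of placing the pair combine to `1 - δ u * δ v`,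
up to sign: this is `0` for two sources or two sinks and `2` for a source and a sink. What remains
is the Laplace expansion of the determinant (`alternatingSplitSum_eq_signedDet`).

Positivity of the determinant follows from that of the correlation, since for `J ≥ 0` every term of
the same high-temperature expansion is nonnegative (`expect_nonneg`). -/

noncomputable section

/-! ### Interlaced paths in a disc -/

section Crossing

/-- The increment of a continuous logarithm along a path that stays in a half-plane. -/
theorem continuousLog_sub_eq {L g : ℝ → ℂ} (hL : Continuous L) (hg : Continuous g) {c : ℂ}
    (hc : c ≠ 0) (hexp : ∀ s, Complex.exp (L s) = g s) (hre : ∀ s, 0 < (g s / c).re) (a b : ℝ) :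
    L b - L a = Complex.log (g b / c) - Complex.log (g a / c) := by
  have hcont : Continuous fun s => L s - Complex.log (g s / c) := by
    refine hL.sub ?_
    refine Continuous.clog (hg.div_const c) fun s => ?_
    exact Or.inl (hre s)
  have hexp' : ∀ s, Complex.exp (L s - Complex.log (g s / c)) = c := by
    intro s
    have h0 : g s ≠ 0 := by rw [← hexp]; exact Complex.exp_ne_zero _
    rw [Complex.exp_sub, hexp, Complex.exp_log (div_ne_zero h0 hc)]
    field_simp
  -- The difference of the two logarithms stays in one fibre of the covering map `exp`, hence is
  -- constant.
  have := Complex.isCoveringMap_exp.const_of_comp hcont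
    (fun s t => Subtype.ext ((hexp' s).trans (hexp' t).symm)) a b
  linear_combination -this

/-- The imaginary part of `log (1 - exp (iφ))` for `0 < φ < 2π`. -/
theorem im_log_one_sub_exp {φ : ℝ} (h0 : 0 < φ) (h1 : φ < 2 * Real.pi) :
    (Complex.log (1 - Complex.exp (φ * Complex.I))).im = (φ - Real.pi) / 2 := by
  have hs : 0 < 2 * Real.sin (φ / 2) := by
    have := Real.sin_pos_of_pos_of_lt_pi (x := φ / 2) (by linarith) (by linarith)
    linarith
  -- Polar form: `1 - exp (iφ) = 2 sin (φ/2) * exp (i(φ - π)/2)`.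
  have key : 1 - Complex.exp (φ * Complex.I) =
      ((2 * Real.sin (φ / 2) : ℝ) : ℂ) *
        (Complex.cos (((φ - Real.pi) / 2 : ℝ)) + Complex.sin (((φ - Real.pi) / 2 : ℝ)) * Complex.I) := by
    have e1 : Real.cos ((φ - Real.pi) / 2) = Real.sin (φ / 2) := by
      rw [show (φ - Real.pi) / 2 = φ / 2 - Real.pi / 2 by ring, Real.cos_sub_pi_div_two]
    have e2 : Real.sin ((φ - Real.pi) / 2) = - Real.cos (φ / 2) := by
      rw [show (φ - Real.pi) / 2 = φ / 2 - Real.pi / 2 by ring, Real.sin_sub_pi_div_two]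
    rw [← Complex.ofReal_cos, ← Complex.ofReal_sin, e1, e2, Complex.exp_mul_I,
      ← Complex.ofReal_cos, ← Complex.ofReal_sin]
    have c2 : Real.cos φ = 1 - 2 * Real.sin (φ / 2) ^ 2 := by
      rw [← Real.cos_sq_add_sin_sq (φ / 2)]
      have := Real.cos_two_mul (φ / 2)
      rw [show 2 * (φ / 2) = φ by ring] at this
      nlinarith [Real.cos_sq_add_sin_sq (φ / 2)]
    have s2 : Real.sin φ = 2 * Real.sin (φ / 2) * Real.cos (φ / 2) := by
      rw [← Real.sin_two_mul]; congr 1; ring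
    rw [c2, s2]
    push_cast
    ring
  rw [Complex.log_im, key, Complex.arg_mul_cos_add_sin_mul_I hs]
  constructor <;> linarith [Real.pi_pos]

theorem im_log_one_sub_exp_of_neg {φ : ℝ} (h0 : φ < 0) (h1 : -(2 * Real.pi) < φ) :
    (Complex.log (1 - Complex.exp (φ * Complex.I))).im = (φ + Real.pi) / 2 := by
  have := im_log_one_sub_exp (φ := φ + 2 * Real.pi) (by linarith) (by linarith)
  rw [show (((φ + 2 * Real.pi : ℝ) : ℂ)) * Complex.I = φ * Complex.I + 2 * Real.pi * Complex.I by
    push_cast; ring, Complex.exp_periodic] at this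
  rw [this]; ring

/-- A closed disc minus a point `p` of its boundary lies in a half-plane with `p` on its boundary. -/
theorem re_sub_div_neg_pos {R : ℝ} {p z : ℂ} (hR : 0 < R) (hp : ‖p‖ = R) (hz : ‖z‖ ≤ R)
    (hne : z ≠ p) : 0 < ((z - p) / (-p)).re := by
  have hp0 : p ≠ 0 := by rw [← norm_pos_iff, hp]; exact hR
  have e : (z - p) / (-p) = 1 - z / p := by field_simp; ring
  rw [e, Complex.sub_re, Complex.one_re, sub_pos]
  have hn : ‖z / p‖ ≤ 1 := by rw [norm_div, hp]; exact (div_le_one hR).2 hz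
  refine lt_of_le_of_ne ((Complex.re_le_norm _).trans hn) fun h => hne ?_
  have h2 : ‖z / p‖ ^ 2 ≤ 1 := by nlinarith [norm_nonneg (z / p)]
  rw [← Complex.normSq_eq_norm_sq, Complex.normSq_apply, h] at h2
  have him : (z / p).im = 0 := by nlinarith [sq_nonneg (z / p).im]
  have : z / p = 1 := Complex.ext h him
  rwa [div_eq_one_iff_eq hp0] at this

/-- Two paths in a closed disc whose ends interlace on the boundary circle meet. -/
theorem exists_eq_of_interlaced {R : ℝ} (hR : 0 < R) {α β : ℝ → ℂ} (hα : Continuous α)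
    (hβ : Continuous β) (hαR : ∀ s, ‖α s‖ ≤ R) (hβR : ∀ s, ‖β s‖ ≤ R) {θ₁ θ₂ θ₃ θ₄ : ℝ}
    (h12 : θ₁ < θ₂) (h23 : θ₂ < θ₃) (h34 : θ₃ < θ₄) (h41 : θ₄ < θ₁ + 2 * Real.pi)
    (hα0 : α 0 = R * Complex.exp (θ₁ * Complex.I)) (hα1 : α 1 = R * Complex.exp (θ₃ * Complex.I))
    (hβ0 : β 0 = R * Complex.exp (θ₂ * Complex.I)) (hβ1 : β 1 = R * Complex.exp (θ₄ * Complex.I)) :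
    ∃ s t, α s = β t := by
  by_contra! hne
  have hR' : (R : ℂ) ≠ 0 := by exact_mod_cast hR.ne'
  let f : C(ℝ × ℝ, ℂ) := ⟨fun x => α x.1 - β x.2, by fun_prop⟩
  have hf : ∀ x, f x ∈ ({0}ᶜ : Set ℂ) := fun x => sub_ne_zero.2 (hne x.1 x.2)
  -- If the paths never meet, `α s - β t` is nonzero on the simply connected parameter plane and has
  -- a continuous logarithm there.
  obtain ⟨L, ⟨-, hL⟩, -⟩ := Complex.isCoveringMapOn_exp.existsUnique_continuousMap_lifts f
    (a₀ := (0, 0)) (Complex.exp_log (hf (0, 0))) hf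
  have hLe : ∀ s t, Complex.exp (L (s, t)) = α s - β t := fun s t => congrFun hL (s, t)
  have hnorm : ∀ θ : ℝ, ‖(R : ℂ) * Complex.exp (θ * Complex.I)‖ = R := fun θ => by
    simp [Complex.norm_exp_ofReal_mul_I, abs_of_pos hR]
  have hpt : ∀ θ : ℝ, (R : ℂ) * Complex.exp (θ * Complex.I) ≠ 0 := fun θ =>
    mul_ne_zero hR' (Complex.exp_ne_zero _)
  have hquot : ∀ θ θ' : ℝ, ((R : ℂ) * Complex.exp (θ * Complex.I) -
      R * Complex.exp (θ' * Complex.I)) / (-(R * Complex.exp (θ' * Complex.I))) =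
      1 - Complex.exp (((θ - θ' : ℝ) : ℂ) * Complex.I) := fun θ θ' => by
    have := Complex.exp_ne_zero (θ' * Complex.I)
    push_cast
    rw [sub_mul, Complex.exp_sub]
    field_simp
    ring
  have hquot' : ∀ θ θ' : ℝ, ((R : ℂ) * Complex.exp (θ' * Complex.I) -
      R * Complex.exp (θ * Complex.I)) / (R * Complex.exp (θ' * Complex.I)) =
      1 - Complex.exp (((θ - θ' : ℝ) : ℂ) * Complex.I) := fun θ θ' => by
    have := Complex.exp_ne_zero (θ' * Complex.I)
    push_cast
    rw [sub_mul, Complex.exp_sub]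
    field_simp
  -- On each side of the unit square one of the two points is fixed on the circle, so the difference
  -- stays in a half-plane and the increment of `L` depends only on the end angles.
  have hor : ∀ (t θ : ℝ), β t = R * Complex.exp (θ * Complex.I) →
      L (1, t) - L (0, t) = Complex.log (1 - Complex.exp (((θ₃ - θ : ℝ) : ℂ) * Complex.I)) -
        Complex.log (1 - Complex.exp (((θ₁ - θ : ℝ) : ℂ) * Complex.I)) := by
    intro t θ ht
    rw [← hquot, ← hquot, ← ht, ← hα0, ← hα1]
    refine continuousLog_sub_eq (L := fun s => L (s, t)) (g := fun s => α s - β t) (by fun_prop)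
      (by fun_prop) ?_ (fun s => hLe s t) (fun s => ?_) 0 1
    · rw [ht]; exact neg_ne_zero.2 (hpt θ)
    · exact re_sub_div_neg_pos hR (by rw [ht, hnorm]) (hαR s) (hne s t)
  have ver : ∀ (s θ : ℝ), α s = R * Complex.exp (θ * Complex.I) →
      L (s, 1) - L (s, 0) = Complex.log (1 - Complex.exp (((θ₄ - θ : ℝ) : ℂ) * Complex.I)) -
        Complex.log (1 - Complex.exp (((θ₂ - θ : ℝ) : ℂ) * Complex.I)) := by
    intro s θ hs
    rw [← hquot', ← hquot', ← hs, ← hβ0, ← hβ1]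
    refine continuousLog_sub_eq (L := fun t => L (s, t)) (g := fun t => α s - β t) (by fun_prop)
      (by fun_prop) ?_ (fun t => hLe s t) (fun t => ?_) 0 1
    · rw [hs]; exact hpt θ
    · have := re_sub_div_neg_pos hR (by rw [hs, hnorm]) (hβR t) (hne s t).symm
      rwa [div_neg, ← neg_div, neg_sub] at this
  have e1 := congrArg Complex.im (hor 0 θ₂ hβ0)
  have e2 := congrArg Complex.im (hor 1 θ₄ hβ1)
  have e3 := congrArg Complex.im (ver 0 θ₁ hα0)
  have e4 := congrArg Complex.im (ver 1 θ₃ hα1)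
  rw [Complex.sub_im, Complex.sub_im, im_log_one_sub_exp (by linarith) (by linarith),
    im_log_one_sub_exp_of_neg (by linarith) (by linarith)] at e1
  rw [Complex.sub_im, Complex.sub_im, im_log_one_sub_exp_of_neg (by linarith) (by linarith),
    im_log_one_sub_exp_of_neg (by linarith) (by linarith)] at e2
  rw [Complex.sub_im, Complex.sub_im, im_log_one_sub_exp (by linarith) (by linarith),
    im_log_one_sub_exp (by linarith) (by linarith)] at e3
  rw [Complex.sub_im, Complex.sub_im, im_log_one_sub_exp (by linarith) (by linarith),
    im_log_one_sub_exp_of_neg (by linarith) (by linarith)] at e4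
  -- The four increments add up around the square to a change of argument of `-2π`, although `L` is
  -- single-valued.
  linarith [Real.pi_pos]

/-- Two path-joined pairs of points that interlace on a circle cannot be joined in disjoint subsets
of the disc. -/
theorem not_disjoint_of_joinedIn_interlaced {R : ℝ} (hR : 0 < R) {S T : Set ℂ}
    (hS : S ⊆ Metric.closedBall 0 R) (hT : T ⊆ Metric.closedBall 0 R) {θ₁ θ₂ θ₃ θ₄ : ℝ}
    (h12 : θ₁ < θ₂) (h23 : θ₂ < θ₃) (h34 : θ₃ < θ₄) (h41 : θ₄ < θ₁ + 2 * Real.pi)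
    (hJS : JoinedIn S (R * Complex.exp (θ₁ * Complex.I)) (R * Complex.exp (θ₃ * Complex.I)))
    (hJT : JoinedIn T (R * Complex.exp (θ₂ * Complex.I)) (R * Complex.exp (θ₄ * Complex.I))) :
    ¬ Disjoint S T := by
  obtain ⟨p, hp⟩ := hJS
  obtain ⟨q, hq⟩ := hJT
  have hpS : ∀ s, p.extend s ∈ S := fun s => hp _
  have hqT : ∀ s, q.extend s ∈ T := fun s => hq _
  obtain ⟨s, t, hst⟩ := exists_eq_of_interlaced hR p.continuous_extend q.continuous_extend
    (fun s => by simpa using hS (hpS s)) (fun s => by simpa using hT (hqT s)) h12 h23 h34 h41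
    p.extend_zero p.extend_one q.extend_zero q.extend_one
  exact Set.not_disjoint_iff.2 ⟨_, hpS s, hst ▸ hqT t⟩

end Crossing

/-! ### From the drawing to noncrossing components -/

namespace PlaneEmbedding

variable {V : Type*} {G : SimpleGraph V} {k : ℕ}

/-- The point `z` of the plane belongs to the vertex `v`: it is the position of `v`, or an inner point
of an edge of `H` at `v`, or a point of a curve that leaves `v`. -/
def BelongsTo (Γ : PlaneEmbedding G) (H : SimpleGraph V) (w : Fin k → V)
    (γ : Fin k → unitInterval → ℂ) (z : ℂ) (v : V) : Prop :=
  z = Γ.pos v ∨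
    (∃ (e : G.edgeSet) (t : unitInterval), 0 < t ∧ t < 1 ∧ (e : Sym2 V) ∈ H.edgeSet ∧
      v ∈ (e : Sym2 V) ∧ z = Γ.arc e t) ∨
    ∃ (i : Fin k) (t : unitInterval), 0 < t ∧ z = γ i t ∧ v = w i

theorem pos_mem_support (Γ : PlaneEmbedding G) (v : V) : Γ.pos v ∈ Γ.support :=
  Or.inl ⟨v, rfl⟩

theorem arc_mem_support (Γ : PlaneEmbedding G) (e : G.edgeSet) (t : unitInterval) :
    Γ.arc e t ∈ Γ.support :=
  Or.inr (Set.mem_iUnion.2 ⟨e, t, rfl⟩)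

/-- Vertices, open edges and curves without their starting points are pairwise disjoint pieces of
the plane. Only an open edge belongs to two vertices, and these are adjacent in `H`. Hence different
components of `H` occupy disjoint sets. -/
theorem BelongsTo.reachable {Γ : PlaneEmbedding G} {H : SimpleGraph V} {w : Fin k → V}
    {γ : Fin k → unitInterval → ℂ} (hout : ∀ i t, 0 < t → γ i t ∈ Γ.outerFace)
    (hdisj : ∀ i j, i ≠ j → Disjoint (Set.range (γ i)) (Set.range (γ j))) {z : ℂ} {v v' : V}
    (h : Γ.BelongsTo H w γ z v) (h' : Γ.BelongsTo H w γ z v') : H.Reachable v v' := by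
  have hadj : ∀ {e : Sym2 V} {a b : V}, e ∈ H.edgeSet → a ∈ e → b ∈ e → H.Reachable a b := by
    intro e a b he ha hb
    by_cases hab : a = b
    · rw [hab]
    · rw [(Sym2.mem_and_mem_iff hab).1 ⟨ha, hb⟩] at he
      exact SimpleGraph.Adj.reachable he
  rcases h with rfl | ⟨e, t, ht0, ht1, heH, hve, rfl⟩ | ⟨i, t, ht, rfl, rfl⟩
  · rcases h' with h' | ⟨e', t', ht0', ht1', heH', hve', h'⟩ | ⟨i', t', ht', h', rfl⟩
    · rw [Γ.pos_injective h']
    · exact absurd ⟨v, h'⟩ (Γ.arc_avoids_vertices e' t' ht0' ht1')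
    · exact absurd (h' ▸ Γ.pos_mem_support v) (hout i' t' ht').1
  · rcases h' with h' | ⟨e', t', ht0', ht1', heH', hve', h'⟩ | ⟨i', t', ht', h', rfl⟩
    · exact absurd ⟨v', h'.symm⟩ (Γ.arc_avoids_vertices e t ht0 ht1)
    · by_cases hee : e = e'
      · subst hee
        exact hadj heH hve hve'
      · exact absurd ⟨t', h'.symm⟩ (Γ.arc_avoids_arcs e e' hee t ht0 ht1)
    · exact absurd (h' ▸ Γ.arc_mem_support e t) (hout i' t' ht').1
  · rcases h' with h' | ⟨e', t', ht0', ht1', heH', hve', h'⟩ | ⟨i', t', ht', h', rfl⟩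
    · exact absurd (h' ▸ Γ.pos_mem_support v') (hout i t ht).1
    · exact absurd (h' ▸ Γ.arc_mem_support e' t') (hout i t ht).1
    · by_cases hii : i = i'
      · rw [hii]
      · exact absurd ⟨t', h'.symm⟩ (Set.disjoint_left.1 (hdisj i i' hii) ⟨t, rfl⟩)

/-- Boundary vertices that interlace along the outer face are not joined by disjoint connected
subgraphs. -/
theorem IsCounterclockwise.reachable_of_interlaced {Γ : PlaneEmbedding G} {w : Fin k → V}
    (hw : Γ.IsCounterclockwise w) {H : SimpleGraph V} (hH : H ≤ G) {a b c d : Fin k}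
    (hab : a < b) (hbc : b < c) (hcd : c < d) (hac : H.Reachable (w a) (w c))
    (hbd : H.Reachable (w b) (w d)) : H.Reachable (w a) (w b) := by
  obtain ⟨R, γ, θ, hball, hγ, hγ0, hout, hγR, hdisj, hγ1, hθ, hθ2⟩ := hw
  have hR : 0 < R := by
    have := hball (Γ.pos_mem_support (w a))
    rw [Metric.mem_ball] at this
    exact dist_nonneg.trans_lt this
  by_contra hnot
  -- `K x` is the drawn component of `x` together with the curves leaving it. It joins points of the
  -- large circle, so the crossing lemma applies to `K (w a)` and `K (w b)`.
  let K : V → Set ℂ := fun x => {z | ∃ v, H.Reachable x v ∧ Γ.BelongsTo H w γ z v}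
  have hKR : ∀ x, K x ⊆ Metric.closedBall 0 R := by
    rintro x z ⟨v, -, rfl | ⟨e, t, -, -, -, -, rfl⟩ | ⟨i, t, -, rfl, -⟩⟩
    · exact Metric.ball_subset_closedBall (hball (Γ.pos_mem_support v))
    · exact Metric.ball_subset_closedBall (hball (Γ.arc_mem_support e t))
    · exact hγR i t
  have hpos : ∀ x v, H.Reachable x v → Γ.pos v ∈ K x := fun x v h => ⟨v, h, Or.inl rfl⟩
  have hstep : ∀ x u v, H.Reachable x u → H.Adj u v → JoinedIn (K x) (Γ.pos u) (Γ.pos v) := by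
    intro x u v hxu huv
    let e : G.edgeSet := ⟨s(u, v), hH huv⟩
    obtain ⟨u', v', he, h0, h1⟩ := Γ.arc_endpoints e
    have hxv : H.Reachable x v := hxu.trans huv.reachable
    have huv' : (u' = u ∧ v' = v) ∨ (u' = v ∧ v' = u) := by
      have : s(u, v) = s(u', v') := he
      rw [Sym2.eq_iff] at this
      tauto
    have hreach : H.Reachable x u' ∧ H.Reachable x v' := by
      rcases huv' with ⟨rfl, rfl⟩ | ⟨rfl, rfl⟩ <;> exact ⟨by assumption, by assumption⟩
    have hJ : JoinedIn (K x) (Γ.pos u') (Γ.pos v') := by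
      refine ⟨⟨⟨Γ.arc e, Γ.arc_continuous e⟩, h0, h1⟩, fun t => ?_⟩
      change Γ.arc e t ∈ K x
      rcases eq_or_lt_of_le (unitInterval.nonneg' (t := t)) with h | ht0
      · rw [← h, h0]; exact hpos _ _ hreach.1
      rcases eq_or_lt_of_le (unitInterval.le_one' (t := t)) with h | ht1
      · rw [h, h1]; exact hpos _ _ hreach.2
      exact ⟨u, hxu, Or.inr (Or.inl ⟨e, t, ht0, ht1, huv, Sym2.mem_mk_left u v, rfl⟩)⟩
    rcases huv' with ⟨rfl, rfl⟩ | ⟨rfl, rfl⟩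
    · exact hJ
    · exact hJ.symm
  have hvert : ∀ x v, H.Reachable x v → JoinedIn (K x) (Γ.pos x) (Γ.pos v) := by
    intro x v h
    rw [SimpleGraph.reachable_iff_reflTransGen] at h
    induction h with
    | refl => exact JoinedIn.refl (hpos _ _ (SimpleGraph.Reachable.refl _))
    | tail hxb hbc ih =>
      exact ih.trans (hstep _ _ _ ((SimpleGraph.reachable_iff_reflTransGen _ _).2 hxb) hbc)
  have hcurve : ∀ x i, H.Reachable x (w i) →
      JoinedIn (K x) (Γ.pos (w i)) (R * Complex.exp (θ i * Complex.I)) := by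
    intro x i h
    refine ⟨⟨⟨γ i, hγ i⟩, hγ0 i, hγ1 i⟩, fun t => ?_⟩
    change γ i t ∈ K x
    rcases eq_or_lt_of_le (unitInterval.nonneg' (t := t)) with h' | ht0
    · rw [← h', hγ0]; exact hpos _ _ h
    · exact ⟨w i, h, Or.inr (Or.inr ⟨i, t, ht0, rfl, rfl⟩)⟩
  have hends : ∀ i j, H.Reachable (w i) (w j) → JoinedIn (K (w i))
      (R * Complex.exp (θ i * Complex.I)) (R * Complex.exp (θ j * Complex.I)) := fun i j h =>
    (hcurve _ i (SimpleGraph.Reachable.refl _)).symm.trans ((hvert _ _ h).trans (hcurve _ j h))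
  refine not_disjoint_of_joinedIn_interlaced hR (hKR (w a)) (hKR (w b)) (hθ hab) (hθ hbc) (hθ hcd)
    (hθ2 d a) (hends a c hac) (hends b d hbd) (Set.disjoint_left.2 ?_)
  rintro z ⟨v, hav, hzv⟩ ⟨v', hbv', hzv'⟩
  exact hnot (hav.trans ((hzv.reachable hout hdisj hzv').trans hbv'.symm))

theorem IsCounterclockwise.injective {Γ : PlaneEmbedding G} {w : Fin k → V}
    (hw : Γ.IsCounterclockwise w) : Function.Injective w := by
  obtain ⟨R, γ, θ, -, -, hγ0, -, -, hdisj, -, -, -⟩ := hw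
  intro i j hij
  by_contra hne
  exact Set.disjoint_left.1 (hdisj i j hne) ⟨0, rfl⟩ ⟨0, by rw [hγ0, hγ0, hij]⟩

end PlaneEmbedding

/-! ### Alternating sums over noncrossing partitions -/

section AlternatingSums

variable {ι : Type*} [LinearOrder ι]

/-- The exponent is the rank of `j` in `S`, so the signs are `1, -1, 1, …` and cancel in pairs. -/
theorem sum_neg_one_pow_card_lt (S : Finset ι) :
    ∑ j ∈ S, (-1 : ℝ) ^ ({i ∈ S | i < j}.card) = if Even S.card then 0 else 1 := by
  induction S using Finset.induction_on_max with
  | empty => simp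
  | insert a s h ih =>
    have ha : a ∉ s := fun h' => lt_irrefl _ (h a h')
    rw [Finset.sum_insert ha, Finset.card_insert_of_notMem ha]
    have e1 : {i ∈ insert a s | i < a} = s := by
      ext i
      simp only [Finset.mem_filter, Finset.mem_insert]
      constructor
      · rintro ⟨rfl | hi, hlt⟩
        · exact absurd hlt (lt_irrefl _)
        · exact hi
      · exact fun hi => ⟨Or.inr hi, h i hi⟩
    have e2 : ∀ j ∈ s, {i ∈ insert a s | i < j} = {i ∈ s | i < j} := by
      intro j hj
      rw [Finset.filter_insert, if_neg (h j hj).not_gt]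
    rw [e1, Finset.sum_congr rfl fun j hj => by rw [e2 j hj], ih]
    by_cases hs : Even s.card
    · simp [hs, hs.neg_one_pow, Nat.even_add_one]
    · simp [hs, (Nat.not_even_iff_odd.1 hs).neg_one_pow, Nat.even_add_one]

/-- For a noncrossing partition into blocks of even size, the alternating sum of a function that is
constant on the blocks vanishes. -/
theorem alternating_sum_eq_zero_of_noncrossing (S : Finset ι) (r : Setoid ι)
    (hnc : ∀ a ∈ S, ∀ b ∈ S, ∀ c ∈ S, ∀ d ∈ S, a < b → b < c → c < d → r a c → r b d → r a b)
    (heven : ∀ j ∈ S, Even (Set.ncard {i | i ∈ S ∧ r i j})) (x : ι → ℝ)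
    (hx : ∀ i j, r i j → x i = x j) :
    ∑ j ∈ S, (-1 : ℝ) ^ ({i ∈ S | i < j}.card) * x j = 0 := by
  classical
  have heven' : ∀ j ∈ S, Even ({i ∈ S | r i j}.card) := fun j hj => by
    rw [← Set.ncard_coe_finset]
    simpa using heven j hj
  -- By noncrossing, another class that meets the gap between `j` and `j'` lies entirely inside it,
  -- so the outsiders in the gap form a union of even classes.
  have hbetween : ∀ c ∈ S, ∀ j ∈ S, ∀ j' ∈ S, r j c → r j' c → j < j' →
      Even ({i ∈ S | ¬ r i c ∧ j < i ∧ i < j'}.card) := by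
    intro c hc j hj j' hj' hjc hjc' hlt
    rw [Finset.card_eq_sum_ones, Finset.sum_partition r]
    refine Finset.even_sum _ fun q hq => ?_
    obtain ⟨y, hy, rfl⟩ := Finset.mem_image.1 hq
    simp only [Finset.mem_filter] at hy
    obtain ⟨hyS, hyc, hjy, hyj⟩ := hy
    rw [← Finset.card_eq_sum_ones]
    refine Eq.mp (congrArg (fun s => Even (Finset.card s)) (Eq.symm ?_)) (heven' y hyS)
    ext z
    simp only [Finset.mem_filter, Quotient.eq]
    constructor
    · rintro ⟨⟨hz, -⟩, h⟩
      exact ⟨hz, h⟩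
    · rintro ⟨hz, h⟩
      have hzc : ¬ r z c := fun h' => hyc (r.trans (r.symm h) h')
      refine ⟨⟨hz, hzc, ?_, ?_⟩, h⟩
      · rcases lt_trichotomy j z with h1 | rfl | h1
        · exact h1
        · exact absurd hjc hzc
        · exact absurd (r.trans (hnc z hz j hj y hyS j' hj' h1 hjy hyj h (r.trans hjc (r.symm hjc'))) hjc) hzc
      · rcases lt_trichotomy z j' with h1 | rfl | h1
        · exact h1
        · exact absurd hjc' hzc
        · exact absurd (r.trans (r.symm (hnc j hj y hyS j' hj' z hz hjy hyj h1
            (r.trans hjc (r.symm hjc')) (r.symm h))) hjc) hyc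
  rw [Finset.sum_partition r]
  refine Finset.sum_eq_zero fun q hq => ?_
  obtain ⟨c, hc, rfl⟩ := Finset.mem_image.1 hq
  -- The number of outsiders below `j` has the same parity for all `j` in the class, so up to a
  -- common sign the rank in `S` can be replaced by the rank in the class.
  have hrank : ∀ j : ι, ({i ∈ S | i < j}.card) =
      ({i ∈ {i ∈ S | r i c} | i < j}.card) + ({i ∈ S | ¬ r i c ∧ i < j}.card) := by
    intro j
    rw [← Finset.card_filter_add_card_filter_not (s := {i ∈ S | i < j}) (fun i => r i c),
      Finset.filter_filter, Finset.filter_filter, Finset.filter_filter]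
    congr 2 <;> ext i <;> simp only [Finset.mem_filter] <;> tauto
  have hparity_lt : ∀ j ∈ S, ∀ j' ∈ S, r j c → r j' c → j < j' →
      (-1 : ℝ) ^ ({i ∈ S | ¬ r i c ∧ i < j}.card) = (-1) ^ ({i ∈ S | ¬ r i c ∧ i < j'}.card) := by
    intro j hj j' hj' hjc hjc' hlt
    have : ({i ∈ S | ¬ r i c ∧ i < j'}.card) = ({i ∈ S | ¬ r i c ∧ i < j}.card) +
        ({i ∈ S | ¬ r i c ∧ j < i ∧ i < j'}.card) := by
      rw [← Finset.card_filter_add_card_filter_not (s := {i ∈ S | ¬ r i c ∧ i < j'}) (fun i => i < j),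
        Finset.filter_filter, Finset.filter_filter]
      congr 2
      · ext i
        simp only [Finset.mem_filter]
        constructor
        · tauto
        · rintro ⟨h1, h2, h3⟩
          exact ⟨h1, ⟨h2, h3.trans hlt⟩, h3⟩
      · ext i
        simp only [Finset.mem_filter, not_lt]
        constructor
        · rintro ⟨h1, ⟨h2, h3⟩, h4⟩
          refine ⟨h1, h2, lt_of_le_of_ne h4 ?_, h3⟩
          rintro rfl
          exact h2 hjc
        · rintro ⟨h1, h2, h3, h4⟩
          exact ⟨h1, ⟨h2, h4⟩, h3.le⟩
    rw [this, pow_add, (hbetween c hc j hj j' hj' hjc hjc' hlt).neg_one_pow, mul_one]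
  have hparity : ∀ j ∈ S, r j c →
      (-1 : ℝ) ^ ({i ∈ S | ¬ r i c ∧ i < j}.card) = (-1) ^ ({i ∈ S | ¬ r i c ∧ i < c}.card) := by
    intro j hj hjc
    rcases lt_trichotomy j c with h | rfl | h
    · exact hparity_lt j hj c hc hjc (r.refl c) h
    · rfl
    · exact (hparity_lt c hc j hj (r.refl c) hjc h).symm
  have hfil : {y ∈ S | (Quotient.mk r y) = Quotient.mk r c} = {i ∈ S | r i c} := by
    ext y
    simp only [Finset.mem_filter, Quotient.eq]
  change ∑ y ∈ {y ∈ S | (Quotient.mk r y) = Quotient.mk r c}, _ = _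
  rw [hfil]
  calc _ = ∑ j ∈ {i ∈ S | r i c}, (-1 : ℝ) ^ ({i ∈ {i ∈ S | r i c} | i < j}.card) *
        ((-1) ^ ({i ∈ S | ¬ r i c ∧ i < c}.card) * x c) := by
        refine Finset.sum_congr rfl fun j hj => ?_
        obtain ⟨hjS, hjc⟩ := Finset.mem_filter.1 hj
        rw [hrank j, pow_add, hparity j hjS hjc, hx j c hjc, mul_assoc]
    _ = 0 := by
        rw [← Finset.sum_mul, sum_neg_one_pow_card_lt, if_pos (heven' c hc), zero_mul]

end AlternatingSums

/-! ### Split sums of Pfaffian functions -/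

section PairingExpansion

variable {ι : Type*} [LinearOrder ι]

theorem sum_powerset_compl {M : Type*} [AddCommMonoid M] (N : Finset ι) (f : Finset ι → M) :
    ∑ S ∈ N.powerset, f (N \ S) = ∑ S ∈ N.powerset, f S := by
  refine Finset.sum_nbij' (fun S => N \ S) (fun S => N \ S) ?_ ?_ ?_ ?_ ?_
  · intro S _; simp
  · intro S _; simp
  · intro S hS; exact Finset.sdiff_sdiff_eq_self (Finset.mem_powerset.1 hS)
  · intro S hS; exact Finset.sdiff_sdiff_eq_self (Finset.mem_powerset.1 hS)
  · intro S _; rfl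

theorem sum_powerset_sum_mem {M : Type*} [AddCommMonoid M] (N : Finset ι) (f : Finset ι → ι → M) :
    ∑ S ∈ N.powerset, ∑ v ∈ S, f S v =
      ∑ v ∈ N, ∑ S ∈ (N.erase v).powerset, f (insert v S) v := by
  have h1 : ∀ S ∈ N.powerset, ∑ v ∈ S, f S v = ∑ v ∈ N, if v ∈ S then f S v else 0 := by
    intro S hS
    rw [← Finset.sum_filter, Finset.filter_mem_eq_inter,
      Finset.inter_eq_right.2 (Finset.mem_powerset.1 hS)]
  rw [Finset.sum_congr rfl h1, Finset.sum_comm]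
  refine Finset.sum_congr rfl fun v hv => ?_
  conv_lhs => rw [← Finset.insert_erase hv]
  rw [Finset.sum_powerset_insert (Finset.notMem_erase v N)]
  rw [Finset.sum_eq_zero, zero_add]
  · exact Finset.sum_congr rfl fun S _ => if_pos (Finset.mem_insert_self v S)
  · intro S hS
    exact if_neg fun h => Finset.notMem_erase v N (Finset.mem_powerset.1 hS h)

/-- The signed sum of `c S * c (N \ S)` over the subsets `S` of `N`. -/
def splitSum (c : Finset ι → ℝ) (N : Finset ι) (ε : ι → ℝ) : ℝ :=
  ∑ S ∈ N.powerset, (∏ x ∈ N \ S, ε x) * (c S * c (N \ S))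

theorem splitSum_congr (c : Finset ι → ℝ) {N : Finset ι} {ε ε' : ι → ℝ}
    (h : ∀ x ∈ N, ε x = ε' x) : splitSum c N ε = splitSum c N ε' :=
  Finset.sum_congr rfl fun S _ => by
    rw [Finset.prod_congr rfl fun x hx => h x (Finset.mem_sdiff.1 hx).1]

/-- The recursion of a Pfaffian with entries `K`, as a property of the function `c` that sends a set
to the Pfaffian of the corresponding submatrix. -/
def IsPfaffianFunction (K : ι → ι → ℝ) (c : Finset ι → ℝ) : Prop :=
  c ∅ = 1 ∧ ∀ (S : Finset ι) (u : ι), (∀ x ∈ S, u < x) →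
    c (insert u S) = ∑ v ∈ S, (-1) ^ ({x ∈ S | x < v}.card) * K u v * c (S.erase v)

/-- The function `ε` with its sign changed at all `x < v`. -/
def flipBelow (v : ι) (ε : ι → ℝ) (x : ι) : ℝ := if x < v then -ε x else ε x

theorem prod_flipBelow (v : ι) (ε : ι → ℝ) (T : Finset ι) :
    ∏ x ∈ T, flipBelow v ε x = (-1) ^ ({x ∈ T | x < v}.card) * ∏ x ∈ T, ε x := by
  have : ∀ x, flipBelow v ε x = (if x < v then -1 else 1) * ε x := by
    intro x; unfold flipBelow; split_ifs <;> ring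
  simp_rw [this]
  rw [Finset.prod_mul_distrib, Finset.prod_ite]
  simp

theorem filter_lt_insert_self (v : ι) (S : Finset ι) :
    {x ∈ insert v S | x < v} = {x ∈ S | x < v} := by
  rw [Finset.filter_insert, if_neg (lt_irrefl v)]

theorem filter_lt_erase_self (v : ι) (S : Finset ι) :
    {x ∈ S.erase v | x < v} = {x ∈ S | x < v} := by
  ext x
  simp only [Finset.mem_filter, Finset.mem_erase]
  exact ⟨fun h => ⟨h.1.2, h.2⟩, fun h => ⟨⟨h.2.ne, h.1⟩, h.2⟩⟩

/-- The recursion is applied to whichever factor contains `u`, and pairs it with a `v` in that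
factor, counting only elements of the factor below `v`. If it is the first factor, this count
differs from the one in `N` by elements of the other factor, whose signs `flipBelow` absorbs. If it
is the second, `flipBelow` absorbs the count itself and `ε u * ε v` remains. -/
theorem IsPfaffianFunction.splitSum_insert {K : ι → ι → ℝ} {c : Finset ι → ℝ}
    (hc : IsPfaffianFunction K c) (N : Finset ι) (u : ι) (hu : ∀ x ∈ N, u < x) (ε : ι → ℝ) :
    splitSum c (insert u N) ε = ∑ v ∈ N, ((-1) ^ ({x ∈ N | x < v}.card) + ε u * ε v) * K u v *
      splitSum c (N.erase v) (flipBelow v ε) := by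
  have huN : u ∉ N := fun h => lt_irrefl _ (hu u h)
  have hfirst : ∑ S ∈ N.powerset, (∏ x ∈ N \ S, ε x) * (c (insert u S) * c (N \ S)) =
      ∑ v ∈ N, (-1) ^ ({x ∈ N | x < v}.card) * K u v * splitSum c (N.erase v) (flipBelow v ε) := by
    have : ∀ S ∈ N.powerset, (∏ x ∈ N \ S, ε x) * (c (insert u S) * c (N \ S)) =
        ∑ v ∈ S, (∏ x ∈ N \ S, ε x) *
          ((-1) ^ ({x ∈ S | x < v}.card) * K u v * c (S.erase v) * c (N \ S)) := by
      intro S hS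
      rw [hc.2 S u fun x hx => hu x (Finset.mem_powerset.1 hS hx), Finset.sum_mul, Finset.mul_sum]
    rw [Finset.sum_congr rfl this, sum_powerset_sum_mem]
    refine Finset.sum_congr rfl fun v hv => ?_
    rw [splitSum, Finset.mul_sum]
    refine Finset.sum_congr rfl fun S hS => ?_
    have hSs := Finset.mem_powerset.1 hS
    have hvS : v ∉ S := fun h => Finset.notMem_erase v N (hSs h)
    have e1 : N \ insert v S = N.erase v \ S := by
      ext x; simp only [Finset.mem_sdiff, Finset.mem_insert, Finset.mem_erase]; tauto
    have e2 : ({x ∈ N | x < v}.card) = ({x ∈ S | x < v}.card) + ({x ∈ N.erase v \ S | x < v}.card) := by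
      rw [← filter_lt_erase_self v N, ← Finset.card_union_of_disjoint, ← Finset.filter_union,
        Finset.union_sdiff_of_subset hSs]
      exact Finset.disjoint_filter_filter Finset.disjoint_sdiff
    rw [e1, filter_lt_insert_self, Finset.erase_insert hvS, prod_flipBelow, e2, pow_add]
    have e3 : ((-1 : ℝ) ^ ({x ∈ N.erase v \ S | x < v}.card)) *
        (-1) ^ ({x ∈ N.erase v \ S | x < v}.card) = 1 := by
      rw [← pow_add, ← two_mul, pow_mul]; simp
    linear_combination (-(-1) ^ ({x ∈ S | x < v}.card) * K u v *
      (∏ x ∈ N.erase v \ S, ε x) * (c S * c (N.erase v \ S))) * e3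
  have hsecond : ∑ S ∈ N.powerset, (∏ x ∈ S, ε x) * (c (insert u S) * c (N \ S)) =
      ∑ v ∈ N, ε v * K u v * splitSum c (N.erase v) (flipBelow v ε) := by
    have : ∀ S ∈ N.powerset, (∏ x ∈ S, ε x) * (c (insert u S) * c (N \ S)) =
        ∑ v ∈ S, (∏ x ∈ S, ε x) *
          ((-1) ^ ({x ∈ S | x < v}.card) * K u v * c (S.erase v) * c (N \ S)) := by
      intro S hS
      rw [hc.2 S u fun x hx => hu x (Finset.mem_powerset.1 hS hx), Finset.sum_mul, Finset.mul_sum]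
    rw [Finset.sum_congr rfl this, sum_powerset_sum_mem]
    refine Finset.sum_congr rfl fun v hv => ?_
    -- Here `S` carries the signs, whereas `splitSum` puts them on the complement.
    rw [splitSum, ← sum_powerset_compl (N.erase v) fun S =>
      (∏ x ∈ N.erase v \ S, flipBelow v ε x) * (c S * c (N.erase v \ S)), Finset.mul_sum]
    refine Finset.sum_congr rfl fun S hS => ?_
    have hSs := Finset.mem_powerset.1 hS
    have hvS : v ∉ S := fun h => Finset.notMem_erase v N (hSs h)
    have e1 : N \ insert v S = N.erase v \ S := by
      ext x; simp only [Finset.mem_sdiff, Finset.mem_insert, Finset.mem_erase]; tauto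
    rw [e1, filter_lt_insert_self, Finset.erase_insert hvS, Finset.prod_insert hvS,
      Finset.sdiff_sdiff_eq_self hSs, prod_flipBelow]
    ring
  rw [splitSum, Finset.sum_powerset_insert huN]
  have t1 : ∀ S ∈ N.powerset, (∏ x ∈ insert u N \ S, ε x) * (c S * c (insert u N \ S)) =
      ε u * ((∏ x ∈ N \ S, ε x) * (c (insert u (N \ S)) * c (N \ (N \ S)))) := by
    intro S hS
    have hSs := Finset.mem_powerset.1 hS
    rw [Finset.insert_sdiff_of_notMem _ fun h => huN (hSs h),
      Finset.prod_insert fun h => huN (Finset.mem_sdiff.1 h).1, Finset.sdiff_sdiff_eq_self hSs]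
    ring
  have t2 : ∀ S ∈ N.powerset, (∏ x ∈ insert u N \ insert u S, ε x) *
      (c (insert u S) * c (insert u N \ insert u S)) =
      (∏ x ∈ N \ S, ε x) * (c (insert u S) * c (N \ S)) := by
    intro S hS
    have : insert u N \ insert u S = N \ S := by
      ext x
      simp only [Finset.mem_sdiff, Finset.mem_insert]
      constructor
      · tauto
      · rintro ⟨h1, h2⟩
        refine ⟨Or.inr h1, ?_⟩
        rintro (rfl | h)
        · exact huN h1
        · exact h2 h
    rw [this]
  rw [Finset.sum_congr rfl t1, Finset.sum_congr rfl t2, ← Finset.mul_sum,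
    sum_powerset_compl N fun T => (∏ x ∈ T, ε x) * (c (insert u T) * c (N \ T)), hfirst, hsecond,
    Finset.mul_sum, ← Finset.sum_add_distrib]
  refine Finset.sum_congr rfl fun v _ => ?_
  ring

/-- `splitSum` with the signs `δ x` twisted by the parity of the index of `x`. -/
def alternatingSplitSum (c : Finset ι → ℝ) (N : Finset ι) (δ : ι → ℝ) : ℝ :=
  splitSum c N fun x => δ x * (-1) ^ ({y ∈ N | y ≤ x}.card)

/-- Deleting `u` and `v` lowers the index by one below `v` and by two above it, so the flip below
`v` restores exactly the parity twist. As `u` has index one, the coefficient factors through `1 - δ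
u * δ v`. -/
theorem IsPfaffianFunction.alternatingSplitSum_insert {K : ι → ι → ℝ} {c : Finset ι → ℝ}
    (hc : IsPfaffianFunction K c) (N : Finset ι) (u : ι) (hu : ∀ x ∈ N, u < x) (δ : ι → ℝ) :
    alternatingSplitSum c (insert u N) δ = ∑ v ∈ N, (-1) ^ ({x ∈ N | x < v}.card) *
      (1 - δ u * δ v) * K u v * alternatingSplitSum c (N.erase v) δ := by
  have huN : u ∉ N := fun h => lt_irrefl _ (hu u h)
  rw [alternatingSplitSum, hc.splitSum_insert N u hu]
  refine Finset.sum_congr rfl fun v hv => ?_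
  have hidx : ∀ x ∈ N, ({y ∈ insert u N | y ≤ x}.card) = ({y ∈ N | y ≤ x}.card) + 1 := by
    intro x hx
    rw [Finset.filter_insert, if_pos (hu x hx).le, Finset.card_insert_of_notMem]
    simp [huN]
  have hidxu : ({y ∈ insert u N | y ≤ u}.card) = 1 := by
    rw [Finset.filter_insert, if_pos le_rfl, Finset.filter_false_of_mem]
    · simp
    · exact fun x hx => (hu x hx).not_ge
  have hidxv : ({y ∈ N | y ≤ v}.card) = ({y ∈ N | y < v}.card) + 1 := by
    have : {y ∈ N | y ≤ v} = insert v {y ∈ N | y < v} := by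
      ext y
      simp only [Finset.mem_filter, Finset.mem_insert, le_iff_lt_or_eq]
      constructor
      · tauto
      · rintro (rfl | h)
        · exact ⟨hv, Or.inr rfl⟩
        · exact ⟨h.1, Or.inl h.2⟩
    rw [this, Finset.card_insert_of_notMem (by simp)]
  have hsplit : splitSum c (N.erase v)
      (flipBelow v fun x => δ x * (-1) ^ ({y ∈ insert u N | y ≤ x}.card)) =
      alternatingSplitSum c (N.erase v) δ := by
    refine splitSum_congr c fun x hx => ?_
    obtain ⟨hxv, hxN⟩ := Finset.mem_erase.1 hx
    rw [flipBelow, hidx x hxN]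
    split_ifs with hlt
    · rw [Finset.filter_erase, Finset.erase_eq_of_notMem (by simp [hlt])]
      ring
    · have hvx : v < x := lt_of_le_of_ne (not_lt.1 hlt) (Ne.symm hxv)
      have hmem : v ∈ {y ∈ N | y ≤ x} := by simp [hv, hvx.le]
      rw [Finset.filter_erase, ← Finset.card_erase_add_one hmem]
      ring
  rw [hsplit, hidxu, hidx v hv, hidxv]
  ring

end PairingExpansion

/-! ### Laplace expansion of the signed determinant -/

section SignedDeterminant

variable {ι : Type*} [LinearOrder ι]

/-- The matrix with rows `P`, columns `Q` and entries `K p q`, with the sign given by the number of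
elements of `P` between `p` and `q`. -/
def signedMatrix (K : ι → ι → ℝ) (P Q : Finset ι) {n : ℕ} (hP : P.card = n) (hQ : Q.card = n) :
    Matrix (Fin n) (Fin n) ℝ :=
  Matrix.of fun i j =>
    (-1) ^ ({r ∈ P | min (P.orderEmbOfFin hP i) (Q.orderEmbOfFin hQ j) < r ∧
      r < max (P.orderEmbOfFin hP i) (Q.orderEmbOfFin hQ j)}.card) *
      K (P.orderEmbOfFin hP i) (Q.orderEmbOfFin hQ j)

/-- The determinant of `signedMatrix`, and `0` if the numbers of rows and columns differ. -/
def signedDet (K : ι → ι → ℝ) (P Q : Finset ι) : ℝ :=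
  if h : P.card = Q.card then (signedMatrix K P Q h rfl).det else 0

theorem signedDet_eq (K : ι → ι → ℝ) {P Q : Finset ι} {n : ℕ} (hP : P.card = n) (hQ : Q.card = n) :
    signedDet K P Q = (signedMatrix K P Q hP hQ).det := by
  subst hQ
  rw [signedDet, dif_pos hP]

theorem orderEmbOfFin_succAbove {S : Finset ι} {n : ℕ} (h : S.card = n + 1) (i : Fin (n + 1))
    {v : ι} (hv : S.orderEmbOfFin h i = v) (h' : (S.erase v).card = n) (j : Fin n) :
    S.orderEmbOfFin h (i.succAbove j) = (S.erase v).orderEmbOfFin h' j := by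
  subst hv
  refine congrFun (Finset.orderEmbOfFin_unique h' (f := fun j => S.orderEmbOfFin h (i.succAbove j))
    (fun j => ?_) fun a b hab => ?_) j
  · refine Finset.mem_erase.2 ⟨fun he => ?_, Finset.orderEmbOfFin_mem _ _ _⟩
    exact Fin.succAbove_ne i j ((S.orderEmbOfFin h).injective he)
  · exact (S.orderEmbOfFin h).strictMono (Fin.strictMono_succAbove i hab)

theorem card_filter_lt_orderEmbOfFin {S : Finset ι} {n : ℕ} (h : S.card = n) (i : Fin n) :
    ({x ∈ S | x < S.orderEmbOfFin h i}.card) = i := by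
  have : {x ∈ S | x < S.orderEmbOfFin h i} =
      (Finset.Iio i).map (S.orderEmbOfFin h).toEmbedding := by
    ext x
    simp only [Finset.mem_filter, Finset.mem_map, Finset.mem_Iio, RelEmbedding.coe_toEmbedding]
    constructor
    · rintro ⟨hx, hlt⟩
      obtain ⟨j, rfl⟩ : x ∈ Set.range (S.orderEmbOfFin h) := by
        rwa [Finset.range_orderEmbOfFin]
      exact ⟨j, (S.orderEmbOfFin h).lt_iff_lt.1 hlt, rfl⟩
    · rintro ⟨j, hj, rfl⟩
      exact ⟨Finset.orderEmbOfFin_mem _ _ _, (S.orderEmbOfFin h).lt_iff_lt.2 hj⟩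
  rw [this, Finset.card_map, Fin.card_Iio]

theorem sum_orderEmbOfFin {S : Finset ι} {n : ℕ} (h : S.card = n) (f : ι → ℝ) :
    ∑ i, f (S.orderEmbOfFin h i) = ∑ x ∈ S, f x := by
  conv_rhs => rw [← Finset.map_orderEmbOfFin_univ S h, Finset.sum_map]
  rfl

theorem prod_orderEmbOfFin {S : Finset ι} {n : ℕ} (h : S.card = n) (f : ι → ℝ) :
    ∏ i, f (S.orderEmbOfFin h i) = ∏ x ∈ S, f x := by
  conv_rhs => rw [← Finset.map_orderEmbOfFin_univ S h, Finset.prod_map]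
  rfl

theorem orderEmbOfFin_zero_insert {S : Finset ι} {n : ℕ} {u : ι} (hu : ∀ x ∈ S, u < x)
    (h : (insert u S).card = n + 1) : (insert u S).orderEmbOfFin h 0 = u := by
  have := Finset.orderEmbOfFin_mem (insert u S) h 0
  rcases Finset.mem_insert.1 this with h' | h'
  · exact h'
  · obtain ⟨j, hj⟩ : u ∈ Set.range ((insert u S).orderEmbOfFin h) := by
      rw [Finset.range_orderEmbOfFin]; simp
    have h1 : (insert u S).orderEmbOfFin h 0 ≤ (insert u S).orderEmbOfFin h j :=
      ((insert u S).orderEmbOfFin h).monotone (Fin.zero_le j)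
    rw [hj] at h1
    exact absurd (hu _ h') h1.not_gt

/-- Expansion along the first row. -/
theorem signedDet_insert_left (K : ι → ι → ℝ) {P Q : Finset ι} {u : ι} (hP : ∀ x ∈ P, u < x)
    (hQ : ∀ x ∈ Q, u < x) (hPQ : Disjoint P Q) :
    signedDet K (insert u P) Q =
      ∑ v ∈ Q, (-1) ^ ({x ∈ P ∪ Q | x < v}.card) * K u v * signedDet K P (Q.erase v) := by
  have huP : u ∉ P := fun h => lt_irrefl _ (hP u h)
  by_cases hcard : (insert u P).card = Q.card
  swap
  -- Removing one row and one column preserves imbalance, so the default value `0` occurs on both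
  -- sides.
  · rw [signedDet, dif_neg hcard, Finset.sum_eq_zero]
    intro v hv
    rw [signedDet, dif_neg, mul_zero]
    rw [Finset.card_insert_of_notMem huP] at hcard
    rw [Finset.card_erase_of_mem hv]
    have := Finset.card_pos.2 ⟨v, hv⟩
    omega
  obtain ⟨n, hn⟩ : ∃ n, P.card = n := ⟨_, rfl⟩
  have hP' : (insert u P).card = n + 1 := by rw [Finset.card_insert_of_notMem huP, hn]
  have hQ' : Q.card = n + 1 := hcard ▸ hP'
  rw [signedDet_eq K hP' hQ', Matrix.det_succ_row_zero, ← sum_orderEmbOfFin hQ']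
  refine Finset.sum_congr rfl fun j _ => ?_
  set v := Q.orderEmbOfFin hQ' j with hv
  have hvQ : v ∈ Q := Finset.orderEmbOfFin_mem _ _ _
  have hE : (Q.erase v).card = n := by rw [Finset.card_erase_of_mem hvQ, hQ']; rfl
  have h0 := orderEmbOfFin_zero_insert hP hP'
  have hPe : ((insert u P).erase u).card = n := by rw [Finset.erase_insert huP, hn]
  have hrow : ∀ i : Fin n, (insert u P).orderEmbOfFin hP' i.succ = P.orderEmbOfFin hn i := by
    intro i
    have := orderEmbOfFin_succAbove hP' 0 h0 hPe i
    rw [Fin.succAbove_zero] at this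
    rw [this]
    congr 2
    exact Finset.erase_insert huP
  have hminor : ((signedMatrix K (insert u P) Q hP' hQ').submatrix Fin.succ j.succAbove) =
      signedMatrix K P (Q.erase v) hn hE := by
    ext a b
    simp only [signedMatrix, Matrix.submatrix_apply, Matrix.of_apply]
    rw [hrow, orderEmbOfFin_succAbove hQ' j hv.symm hE, Finset.filter_insert, if_neg]
    rintro ⟨h1, -⟩
    rw [min_lt_iff] at h1
    rcases h1 with h1 | h1
    · exact h1.not_gt (hP _ (Finset.orderEmbOfFin_mem _ _ _))
    · exact h1.not_gt (hQ _ (Finset.mem_of_mem_erase (Finset.orderEmbOfFin_mem _ _ _)))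
  have hentry : signedMatrix K (insert u P) Q hP' hQ' 0 j =
      (-1) ^ ({x ∈ P | x < v}.card) * K u v := by
    simp only [signedMatrix, Matrix.of_apply]
    rw [h0, ← hv, min_eq_left (hQ v hvQ).le, max_eq_right (hQ v hvQ).le, Finset.filter_insert,
      if_neg (by simp)]
    congr 3
    refine Finset.filter_congr fun x hx => ?_
    simp [hP x hx]
  -- The entry's sign counts the elements of `P` below `v`, the cofactor's sign those of `Q`.
  have hsign : ({x ∈ P ∪ Q | x < v}.card) = ({x ∈ P | x < v}.card) + j := by
    rw [Finset.filter_union, Finset.card_union_of_disjoint (Finset.disjoint_filter_filter hPQ),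
      hv, card_filter_lt_orderEmbOfFin hQ' j]
  rw [hminor, hentry, signedDet_eq K hn hE, hsign]
  ring

/-- Expansion along the first column. -/
theorem signedDet_insert_right (K : ι → ι → ℝ) (hK : ∀ x y, K x y = K y x) {P Q : Finset ι} {u : ι}
    (hP : ∀ x ∈ P, u < x) (hQ : ∀ x ∈ Q, u < x) (hPQ : Disjoint P Q) :
    signedDet K P (insert u Q) =
      ∑ v ∈ P, (-1) ^ ({x ∈ P ∪ Q | x < v}.card) * K u v * signedDet K (P.erase v) Q := by
  have huQ : u ∉ Q := fun h => lt_irrefl _ (hQ u h)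
  by_cases hcard : P.card = (insert u Q).card
  swap
  · rw [signedDet, dif_neg hcard, Finset.sum_eq_zero]
    intro v hv
    rw [signedDet, dif_neg, mul_zero]
    rw [Finset.card_insert_of_notMem huQ] at hcard
    rw [Finset.card_erase_of_mem hv]
    have := Finset.card_pos.2 ⟨v, hv⟩
    omega
  obtain ⟨n, hn⟩ : ∃ n, Q.card = n := ⟨_, rfl⟩
  have hQ' : (insert u Q).card = n + 1 := by rw [Finset.card_insert_of_notMem huQ, hn]
  have hP' : P.card = n + 1 := hcard ▸ hQ'
  rw [signedDet_eq K hP' hQ', Matrix.det_succ_column_zero, ← sum_orderEmbOfFin hP']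
  refine Finset.sum_congr rfl fun i _ => ?_
  set v := P.orderEmbOfFin hP' i with hv
  have hvP : v ∈ P := Finset.orderEmbOfFin_mem _ _ _
  have hE : (P.erase v).card = n := by rw [Finset.card_erase_of_mem hvP, hP']; rfl
  have h0 := orderEmbOfFin_zero_insert hQ hQ'
  have hQe : ((insert u Q).erase u).card = n := by rw [Finset.erase_insert huQ, hn]
  have hcol : ∀ i : Fin n, (insert u Q).orderEmbOfFin hQ' i.succ = Q.orderEmbOfFin hn i := by
    intro i
    have := orderEmbOfFin_succAbove hQ' 0 h0 hQe i
    rw [Fin.succAbove_zero] at this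
    rw [this]
    congr 2
    exact Finset.erase_insert huQ
  -- Deleting the row `v` changes the sign of the entry at `p, q` exactly when `v` lies between
  -- them, that is, when `sg p * sg q = -1`. This rescales rows and columns.
  let sg : ι → ℝ := fun x => if v < x then -1 else 1
  have hminor : ((signedMatrix K P (insert u Q) hP' hQ').submatrix i.succAbove Fin.succ) =
      Matrix.of fun a b => sg ((P.erase v).orderEmbOfFin hE a) *
        (Matrix.of fun a b => sg (Q.orderEmbOfFin hn b) *
          signedMatrix K (P.erase v) Q hE hn a b) a b := by
    ext a b
    simp only [signedMatrix, Matrix.submatrix_apply, Matrix.of_apply]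
    rw [hcol, orderEmbOfFin_succAbove hP' i hv.symm hE]
    have hp := Finset.orderEmbOfFin_mem (P.erase v) hE a
    have hq := Finset.orderEmbOfFin_mem Q hn b
    set p := (P.erase v).orderEmbOfFin hE a
    set q := Q.orderEmbOfFin hn b
    have hpv : p ≠ v := (Finset.mem_erase.1 hp).1
    have hqv : q ≠ v := fun h => Finset.disjoint_left.1 hPQ hvP (h ▸ hq)
    conv_lhs => rw [← Finset.insert_erase hvP]
    rw [Finset.filter_insert]
    have hnot : v ∉ {r ∈ P.erase v | min p q < r ∧ r < max p q} := by simp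
    simp only [sg]
    rcases lt_or_gt_of_ne hpv with h1 | h1 <;> rcases lt_or_gt_of_ne hqv with h2 | h2
    · rw [if_neg (by simp [h1.le, h2.le]), if_neg h1.not_gt, if_neg h2.not_gt]; ring
    · rw [if_pos (by simp [h1, h2]), if_neg h1.not_gt, if_pos h2,
        Finset.card_insert_of_notMem hnot]; ring
    · rw [if_pos (by simp [h1, h2]), if_pos h1, if_neg h2.not_gt,
        Finset.card_insert_of_notMem hnot]; ring
    · rw [if_neg (by simp [h1.le, h2.le]), if_pos h1, if_pos h2]; ring
  have hentry : signedMatrix K P (insert u Q) hP' hQ' i 0 = (-1) ^ (i : ℕ) * K u v := by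
    simp only [signedMatrix, Matrix.of_apply]
    rw [h0, ← hv, min_eq_right (hP v hvP).le, max_eq_left (hP v hvP).le, hK]
    congr 2
    rw [← card_filter_lt_orderEmbOfFin hP' i, ← hv]
    congr 1
    refine Finset.filter_congr fun x hx => ?_
    simp [hP x hx]
  have hprod : ∀ T : Finset ι, ∏ x ∈ T, sg x = (-1) ^ ({x ∈ T | v < x}.card) := by
    intro T
    simp only [sg]
    rw [Finset.prod_ite]
    simp
  -- Besides `v` there are `2 * n` elements, so as many lie below `v` as above it modulo 2.
  have hsign : ((-1 : ℝ) ^ ({x ∈ P ∪ Q | x < v}.card)) =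
      (-1) ^ ({x ∈ P.erase v | v < x}.card) * (-1) ^ ({x ∈ Q | v < x}.card) := by
    have hdis : Disjoint (P.erase v) Q := hPQ.mono_left (Finset.erase_subset _ _)
    have htot : ({x ∈ P ∪ Q | x < v}.card) + (({x ∈ P.erase v | v < x}.card) +
        ({x ∈ Q | v < x}.card)) = 2 * n := by
      rw [← Finset.card_union_of_disjoint (Finset.disjoint_filter_filter hdis),
        ← Finset.filter_union, ← filter_lt_erase_self v (P ∪ Q), Finset.erase_union_distrib,
        Finset.erase_eq_of_notMem (s := Q) fun h => Finset.disjoint_left.1 hPQ hvP h]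
      have : {x ∈ P.erase v ∪ Q | v < x} = {x ∈ P.erase v ∪ Q | ¬ x < v} := by
        refine Finset.filter_congr fun x hx => ?_
        have hxv : x ≠ v := by
          rintro rfl
          rcases Finset.mem_union.1 hx with h | h
          · exact Finset.notMem_erase _ _ h
          · exact Finset.disjoint_left.1 hPQ hvP h
        rw [not_lt]
        exact ⟨le_of_lt, fun h => lt_of_le_of_ne h hxv.symm⟩
      rw [this, Finset.card_filter_add_card_filter_not, Finset.card_union_of_disjoint hdis, hE, hn]
      ring
    have h1 : (-1 : ℝ) ^ ({x ∈ P ∪ Q | x < v}.card) * ((-1) ^ ({x ∈ P.erase v | v < x}.card) *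
        (-1) ^ ({x ∈ Q | v < x}.card)) = 1 := by
      rw [← pow_add, ← pow_add, htot, pow_mul]; simp
    have hsq : ∀ m : ℕ, ((-1 : ℝ) ^ m) * (-1) ^ m = 1 := fun m => by
      rw [← pow_add, ← two_mul, pow_mul]; simp
    have h2 := hsq ({x ∈ P ∪ Q | x < v}.card)
    linear_combination ((-1 : ℝ) ^ ({x ∈ P.erase v | v < x}.card) *
      (-1) ^ ({x ∈ Q | v < x}.card)) * h2 - (-1 : ℝ) ^ ({x ∈ P ∪ Q | x < v}.card) * h1
  rw [hminor, hentry, Matrix.det_mul_column, Matrix.det_mul_row, prod_orderEmbOfFin hE sg,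
    prod_orderEmbOfFin hn sg, hprod, hprod, signedDet_eq K hE hn, hsign]
  have hsq : ((-1 : ℝ) ^ (i : ℕ)) * (-1) ^ (i : ℕ) = 1 := by
    rw [← pow_add, ← two_mul, pow_mul]; simp
  linear_combination (K u v * (-1 : ℝ) ^ ({x ∈ P.erase v | v < x}.card) *
    (-1) ^ ({x ∈ Q | v < x}.card) * (signedMatrix K (P.erase v) Q hE hn).det) * hsq

/-- The split sum of a Pfaffian function is a determinant. -/
theorem IsPfaffianFunction.alternatingSplitSum_eq_signedDet {K : ι → ι → ℝ} {c : Finset ι → ℝ}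
    (hc : IsPfaffianFunction K c) (hK : ∀ x y, K x y = K y x) (δ : ι → ℝ) :
    ∀ (P Q : Finset ι), (∀ x ∈ P, δ x = 1) → (∀ x ∈ Q, δ x = -1) →
      alternatingSplitSum c (P ∪ Q) δ = 2 ^ P.card * signedDet K P Q := by
  suffices H : ∀ (n : ℕ) (P Q : Finset ι), (P ∪ Q).card = n → (∀ x ∈ P, δ x = 1) →
      (∀ x ∈ Q, δ x = -1) → alternatingSplitSum c (P ∪ Q) δ = 2 ^ P.card * signedDet K P Q from
    fun P Q => H _ P Q rfl
  intro n
  induction n using Nat.strong_induction_on with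
  | _ n ih =>
  intro P Q hn hP hQ
  have hPQ : Disjoint P Q := Finset.disjoint_left.2 fun x h1 h2 => by
    have := (hP x h1).symm.trans (hQ x h2)
    norm_num at this
  rcases (P ∪ Q).eq_empty_or_nonempty with he | hne
  · obtain ⟨rfl, rfl⟩ := Finset.union_eq_empty.1 he
    simp [alternatingSplitSum, splitSum, hc.1, signedDet, signedMatrix]
  obtain ⟨u, hmem, hmin⟩ : ∃ u ∈ P ∪ Q, ∀ x ∈ P ∪ Q, u ≤ x :=
    ⟨_, Finset.min'_mem _ hne, fun x hx => Finset.min'_le _ x hx⟩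
  rcases Finset.mem_union.1 hmem with hu | hu
  · obtain ⟨P, huP, rfl⟩ : ∃ P', u ∉ P' ∧ P = insert u P' :=
      ⟨P.erase u, Finset.notMem_erase _ _, (Finset.insert_erase hu).symm⟩
    have huQ : u ∉ Q := Finset.disjoint_left.1 hPQ hu
    have hPu : ∀ x ∈ P, u < x := fun x hx =>
      lt_of_le_of_ne (hmin x (by simp [hx])) (by rintro rfl; exact huP hx)
    have hQu : ∀ x ∈ Q, u < x := fun x hx =>
      lt_of_le_of_ne (hmin x (by simp [hx])) (by rintro rfl; exact huQ hx)
    have hdis : Disjoint P Q := hPQ.mono_left (Finset.subset_insert _ _)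
    rw [Finset.insert_union] at hn ⊢
    have huPQ : u ∉ P ∪ Q := by simp [huP, huQ]
    rw [Finset.card_insert_of_notMem huPQ] at hn
    -- Partners of `u` in `P` have coefficient `1 - 1 = 0`; those in `Q` match the expansion along
    -- the row of `u`.
    rw [hc.alternatingSplitSum_insert _ _ (fun x hx => (Finset.mem_union.1 hx).elim (hPu x) (hQu x)),
      Finset.sum_union hdis, Finset.sum_eq_zero, zero_add, signedDet_insert_left K hPu hQu hdis,
      Finset.mul_sum, Finset.card_insert_of_notMem huP]
    · refine Finset.sum_congr rfl fun v hv => ?_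
      have hvP : v ∉ P := Finset.disjoint_right.1 hdis hv
      have e : (P ∪ Q).erase v = P ∪ Q.erase v := by
        rw [Finset.erase_union_distrib, Finset.erase_eq_of_notMem hvP]
      have hlt : (P ∪ Q.erase v).card < n := by
        rw [← e, Finset.card_erase_of_mem (Finset.mem_union_right _ hv)]; omega
      rw [e, ih _ hlt P (Q.erase v) rfl (fun x hx => hP x (Finset.mem_insert_of_mem hx))
        (fun x hx => hQ x (Finset.mem_of_mem_erase hx)), hP u hu, hQ v hv]
      ring
    · intro v hv
      rw [hP u hu, hP v (Finset.mem_insert_of_mem hv)]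
      ring
  · obtain ⟨Q, huQ, rfl⟩ : ∃ Q', u ∉ Q' ∧ Q = insert u Q' :=
      ⟨Q.erase u, Finset.notMem_erase _ _, (Finset.insert_erase hu).symm⟩
    have huP : u ∉ P := Finset.disjoint_right.1 hPQ hu
    have hPu : ∀ x ∈ P, u < x := fun x hx =>
      lt_of_le_of_ne (hmin x (by simp [hx])) (by rintro rfl; exact huP hx)
    have hQu : ∀ x ∈ Q, u < x := fun x hx =>
      lt_of_le_of_ne (hmin x (by simp [hx])) (by rintro rfl; exact huQ hx)
    have hdis : Disjoint P Q := hPQ.mono_right (Finset.subset_insert _ _)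
    rw [Finset.union_insert] at hn ⊢
    have huPQ : u ∉ P ∪ Q := by simp [huP, huQ]
    rw [Finset.card_insert_of_notMem huPQ] at hn
    rw [hc.alternatingSplitSum_insert _ _ (fun x hx => (Finset.mem_union.1 hx).elim (hPu x) (hQu x)),
      Finset.sum_union hdis, add_comm, Finset.sum_eq_zero, zero_add,
      signedDet_insert_right K hK hPu hQu hdis, Finset.mul_sum]
    · refine Finset.sum_congr rfl fun v hv => ?_
      have hvQ : v ∉ Q := Finset.disjoint_left.1 hdis hv
      have e : (P ∪ Q).erase v = P.erase v ∪ Q := by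
        rw [Finset.erase_union_distrib, Finset.erase_eq_of_notMem hvQ]
      have hlt : (P.erase v ∪ Q).card < n := by
        rw [← e, Finset.card_erase_of_mem (Finset.mem_union_left _ hv)]; omega
      rw [e, ih _ hlt (P.erase v) Q rfl (fun x hx => hP x (Finset.mem_of_mem_erase hx))
        (fun x hx => hQ x (Finset.mem_insert_of_mem hx)), hQ u hu, hP v hv,
        ← Finset.card_erase_add_one hv]
      ring
    · intro v hv
      rw [hQ u hu, hQ v (Finset.mem_insert_of_mem hv)]
      ring

end SignedDeterminant

/-! ### High-temperature expansion of two Ising models -/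

namespace AshkinTeller

section Spins

variable {V : Type*}

theorem spin_mul (s t : Spins V) (v : V) : spin (s * t) v = spin s v * spin t v := by
  simp [spin]

theorem spin_mul_self (s : Spins V) (v : V) : spin s v * spin s v = 1 := by
  rcases Int.units_eq_one_or (s v) with h | h <;> simp [spin, h]

theorem edgeSpin_mk (s : Spins V) (u v : V) : edgeSpin s s(u, v) = spin s u * spin s v := rfl

theorem edgeSpin_mul (s t : Spins V) (e : Sym2 V) :
    edgeSpin (s * t) e = edgeSpin s e * edgeSpin t e := by
  induction e with
  | _ u v => simp only [edgeSpin_mk, spin_mul]; ring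

theorem edgeSpin_mul_self (s : Spins V) (e : Sym2 V) : edgeSpin s e * edgeSpin s e = 1 := by
  induction e with
  | _ u v =>
    rw [edgeSpin_mk]
    linear_combination (spin s v * spin s v) * spin_mul_self s u + spin_mul_self s v

theorem eq_one_or_neg_one_of_mul_self {x : ℝ} (h : x * x = 1) : x = 1 ∨ x = -1 :=
  mul_self_eq_one_iff.1 h

/-- The product of the spins over a family of nodes, times the product of the edge spins over a set
of edges: a character of the group of spin configurations. -/
def spinCharacter {ι : Type*} (x : ι → V) (S : Finset ι) (η : Finset (Sym2 V)) (s : Spins V) : ℝ :=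
  (∏ p ∈ S, spin s (x p)) * ∏ e ∈ η, edgeSpin s e

variable {ι : Type*} (x : ι → V) (S : Finset ι) (η : Finset (Sym2 V))

theorem spinCharacter_mul (s t : Spins V) :
    spinCharacter x S η (s * t) = spinCharacter x S η s * spinCharacter x S η t := by
  simp only [spinCharacter, spin_mul, edgeSpin_mul, Finset.prod_mul_distrib]
  ring

theorem spinCharacter_mul_self (s : Spins V) :
    spinCharacter x S η s * spinCharacter x S η s = 1 := by
  rw [← spinCharacter_mul]
  have : s * s = 1 := funext fun v => by
    rcases Int.units_eq_one_or (s v) with h | h <;> simp [h]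
  rw [this]
  simp only [spinCharacter]
  rw [Finset.prod_eq_one, Finset.prod_eq_one, one_mul]
  · intro e _
    induction e with
    | _ u v => simp [edgeSpin_mk, spin]
  · intro p _
    simp [spin]

variable [Fintype V] [DecidableEq V]

/-- Translation by an element where the character is `-1` changes the sign of the sum. -/
theorem sum_spinCharacter_eq_zero (h : ¬ ∀ t, spinCharacter x S η t = 1) :
    ∑ s, spinCharacter x S η s = 0 := by
  push Not at h
  obtain ⟨t, ht⟩ := h
  have ht' := (eq_one_or_neg_one_of_mul_self (spinCharacter_mul_self x S η t)).resolve_left ht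
  have := Equiv.sum_comp (Equiv.mulRight t) (spinCharacter x S η)
  simp only [Equiv.coe_mulRight, spinCharacter_mul, ht'] at this
  rw [← Finset.sum_mul] at this
  linarith

theorem sum_spinCharacter_nonneg : 0 ≤ ∑ s, spinCharacter x S η s := by
  by_cases h : ∀ t, spinCharacter x S η t = 1
  · exact Finset.sum_nonneg fun s _ => by rw [h s]; exact zero_le_one
  · rw [sum_spinCharacter_eq_zero x S η h]


end Spins

section Weight

variable {V : Type*} [Fintype V] (G : SimpleGraph V) [DecidableRel G.Adj] (J : Sym2 V → ℝ)

/-- The unnormalised weight of a single Ising configuration. -/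
def isingWeight (s : Spins V) : ℝ := ∏ e ∈ G.edgeFinset, Real.exp (J e * edgeSpin s e)

theorem weight_zero (s s' : Spins V) :
    weight G J 0 s s' = isingWeight G J s * isingWeight G J s' := by
  simp only [weight, isingWeight, ← Finset.prod_mul_distrib, ← Real.exp_add]
  refine Finset.prod_congr rfl fun e _ => ?_
  simp only [Pi.zero_apply]
  congr 1
  ring

end Weight

section Ising

variable {V : Type*} [Fintype V] [DecidableEq V] (G : SimpleGraph V) [DecidableRel G.Adj]
  (J : Sym2 V → ℝ)

/-- The partition function of a single Ising model. -/
def isingPartition : ℝ := ∑ s : Spins V, isingWeight G J s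

/-- The expectation in a single Ising model. -/
def isingExpect (f : Spins V → ℝ) : ℝ := (∑ s, f s * isingWeight G J s) / isingPartition G J

theorem isingPartition_pos : 0 < isingPartition G J :=
  Finset.sum_pos (fun _ _ => Finset.prod_pos fun _ _ => Real.exp_pos _) Finset.univ_nonempty

theorem partitionFunction_zero :
    partitionFunction G J 0 = isingPartition G J * isingPartition G J := by
  simp only [partitionFunction, isingPartition, weight_zero, Finset.sum_mul_sum]

theorem expect_eq (F : Spins V → Spins V → ℝ) :
    expect G J 0 F = (∑ s, ∑ s', F s s' * (isingWeight G J s * isingWeight G J s')) /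
      (isingPartition G J * isingPartition G J) := by
  simp only [expect, weight_zero, partitionFunction_zero, Finset.sum_div, mul_div_assoc]

theorem expect_mul (f g : Spins V → ℝ) :
    expect G J 0 (fun s s' => f s * g s') = isingExpect G J f * isingExpect G J g := by
  rw [expect_eq, isingExpect, isingExpect, div_mul_div_comm, Finset.sum_mul_sum]
  congr 1
  refine Finset.sum_congr rfl fun s _ => Finset.sum_congr rfl fun s' _ => ?_
  ring

theorem isingExpect_one : isingExpect G J (fun _ => 1) = 1 := by
  simp only [isingExpect, one_mul]
  exact div_self (isingPartition_pos G J).ne'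

theorem twoPoint_zero (u v : V) :
    twoPoint G J 0 u v = isingExpect G J fun s => spin s u * spin s v := by
  have := expect_mul G J (fun s => spin s u * spin s v) fun _ => 1
  simpa [isingExpect_one, twoPoint] using this

theorem expect_finset_sum {α : Type*} (T : Finset α) (F : α → Spins V → Spins V → ℝ) :
    expect G J 0 (fun s s' => ∑ a ∈ T, F a s s') = ∑ a ∈ T, expect G J 0 (F a) := by
  simp only [expect, Finset.sum_mul]
  rw [Finset.sum_congr rfl fun s _ => Finset.sum_comm, Finset.sum_comm]

theorem expect_const_mul (a : ℝ) (F : Spins V → Spins V → ℝ) :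
    expect G J 0 (fun s s' => a * F s s') = a * expect G J 0 F := by
  simp only [expect_eq, mul_assoc, ← Finset.mul_sum, mul_div_assoc]

theorem exp_mul_eq_cosh_add_sinh {a b : ℝ} (hb : b * b = 1) :
    Real.exp (a * b) = Real.sinh a * b + Real.cosh a := by
  rcases eq_one_or_neg_one_of_mul_self hb with rfl | rfl
  · rw [mul_one, mul_one, Real.sinh_add_cosh]
  · rw [mul_neg_one, ← Real.cosh_sub_sinh]; ring

/-- An edge contributes `exp (a * edgeSpin s e)` with `a = J e * (1 + edgeSpin t e)`, which is
affine in `edgeSpin s e` because that is `±1`. -/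
theorem isingWeight_mul_isingWeight (s t : Spins V) :
    isingWeight G J s * isingWeight G J (s * t) = ∑ η ∈ G.edgeFinset.powerset,
      ((∏ e ∈ η, Real.sinh (J e * (1 + edgeSpin t e))) *
        ∏ e ∈ G.edgeFinset \ η, Real.cosh (J e * (1 + edgeSpin t e))) * ∏ e ∈ η, edgeSpin s e := by
  have : isingWeight G J s * isingWeight G J (s * t) = ∏ e ∈ G.edgeFinset,
      (Real.sinh (J e * (1 + edgeSpin t e)) * edgeSpin s e +
        Real.cosh (J e * (1 + edgeSpin t e))) := by
    simp only [isingWeight, ← Finset.prod_mul_distrib, ← Real.exp_add]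
    refine Finset.prod_congr rfl fun e _ => ?_
    rw [← exp_mul_eq_cosh_add_sinh (edgeSpin_mul_self s e), edgeSpin_mul]
    congr 1
    ring
  rw [this, Finset.prod_add]
  refine Finset.sum_congr rfl fun η _ => ?_
  rw [Finset.prod_mul_distrib]
  ring

/-- The high-temperature expansion of a pair of Ising models in terms of the product `t` of the two
spin configurations. -/
theorem sum_sum_isingWeight {ι : Type*} (x : ι → V) (S : Finset ι) (g : Spins V → ℝ) :
    ∑ s, ∑ s', ((∏ p ∈ S, spin s (x p)) * g (s * s')) * (isingWeight G J s * isingWeight G J s') =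
      ∑ t, ∑ η ∈ G.edgeFinset.powerset, g t *
        (((∏ e ∈ η, Real.sinh (J e * (1 + edgeSpin t e))) *
          ∏ e ∈ G.edgeFinset \ η, Real.cosh (J e * (1 + edgeSpin t e))) *
            ∑ s, spinCharacter x S η s) := by
  have hss : ∀ s t : Spins V, s * (s * t) = t := fun s t => funext fun v => by
    rcases Int.units_eq_one_or (s v) with h | h <;> simp [h]
  have h1 : ∀ s : Spins V, ∑ s', ((∏ p ∈ S, spin s (x p)) * g (s * s')) *
      (isingWeight G J s * isingWeight G J s') = ∑ t, ((∏ p ∈ S, spin s (x p)) * g t) *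
      (isingWeight G J s * isingWeight G J (s * t)) := by
    intro s
    rw [← Equiv.sum_comp (Equiv.mulLeft s)]
    simp only [Equiv.coe_mulLeft, hss]
  simp_rw [h1]
  rw [Finset.sum_comm]
  refine Finset.sum_congr rfl fun t _ => ?_
  simp_rw [isingWeight_mul_isingWeight, Finset.mul_sum]
  rw [Finset.sum_comm]
  refine Finset.sum_congr rfl fun η _ => Finset.sum_congr rfl fun s _ => ?_
  rw [spinCharacter]
  ring

theorem expect_nonneg (hJ : ∀ e ∈ G.edgeFinset, 0 ≤ J e) {ι : Type*} (x : ι → V) (S : Finset ι)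
    {g : Spins V → ℝ} (hg : ∀ t, 0 ≤ g t) :
    0 ≤ expect G J 0 fun s s' => (∏ p ∈ S, spin s (x p)) * g (s * s') := by
  rw [expect_eq, sum_sum_isingWeight]
  refine div_nonneg (Finset.sum_nonneg fun t _ => Finset.sum_nonneg fun η hη => ?_)
    (mul_self_nonneg _)
  refine mul_nonneg (hg t) (mul_nonneg (mul_nonneg (Finset.prod_nonneg fun e he => ?_)
    (Finset.prod_nonneg fun e _ => (Real.cosh_pos _).le)) (sum_spinCharacter_nonneg x S η))
  refine Real.sinh_nonneg_iff.2 (mul_nonneg (hJ e (Finset.mem_powerset.1 hη he)) ?_)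
  rcases eq_one_or_neg_one_of_mul_self (edgeSpin_mul_self t e) with h | h <;> rw [h] <;> norm_num

theorem expect_eq_zero {ι : Type*} (x : ι → V) (S : Finset ι) {g : Spins V → ℝ}
    (hg : ∀ (t : Spins V) (η : Finset (Sym2 V)), η ⊆ G.edgeFinset → (∀ e ∈ η, edgeSpin t e = 1) →
      (∀ s, spinCharacter x S η s = 1) → g t = 0) :
    expect G J 0 (fun s s' => (∏ p ∈ S, spin s (x p)) * g (s * s')) = 0 := by
  rw [expect_eq, sum_sum_isingWeight, Finset.sum_eq_zero, zero_div]
  refine fun t _ => Finset.sum_eq_zero fun η hη => ?_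
  by_cases hχ : ∀ s, spinCharacter x S η s = 1
  swap
  · rw [sum_spinCharacter_eq_zero x S η hχ, mul_zero, mul_zero]
  by_cases ht : ∀ e ∈ η, edgeSpin t e = 1
  · rw [hg t η (Finset.mem_powerset.1 hη) ht hχ, zero_mul]
  · push Not at ht
    obtain ⟨e, he, hne⟩ := ht
    have h' := (eq_one_or_neg_one_of_mul_self (edgeSpin_mul_self t e)).resolve_left hne
    -- Across an edge where `t` disagrees the effective coupling is zero, and so is its `sinh`.
    rw [Finset.prod_eq_zero he (by rw [h']; simp), zero_mul, zero_mul, mul_zero]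

end Ising

/-! ### Pfaffian recursion for boundary spins -/

section Boundary

variable {V : Type*} [Fintype V] [DecidableEq V]

/-- Vertices listed (with repetitions) by a linear order such that no two disjoint connected subgraphs
contain interlacing pairs of them. -/
def IsNoncrossing (G : SimpleGraph V) {ι : Type*} [LinearOrder ι] (x : ι → V) : Prop :=
  ∀ H ≤ G, ∀ a b c d : ι, a < b → b < c → c < d → H.Reachable (x a) (x c) →
    H.Reachable (x b) (x d) → H.Reachable (x a) (x b)

theorem alternating_sum_spin_eq_zero {G : SimpleGraph V} [DecidableRel G.Adj] {ι : Type*}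
    [LinearOrder ι] {x : ι → V} (hx : IsNoncrossing G x) (S : Finset ι) {t : Spins V}
    {η : Finset (Sym2 V)} (hη : η ⊆ G.edgeFinset) (ht : ∀ e ∈ η, edgeSpin t e = 1)
    (hχ : ∀ s, spinCharacter x S η s = 1) :
    ∑ j ∈ S, (-1 : ℝ) ^ ({i ∈ S | i < j}.card) * spin t (x j) = 0 := by
  classical
  let H : SimpleGraph V := SimpleGraph.fromEdgeSet (η : Set (Sym2 V))
  have hHG : H ≤ G := by
    intro u v huv
    have := hη (Finset.mem_coe.1 ((SimpleGraph.fromEdgeSet_adj _).1 huv).1)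
    rwa [SimpleGraph.mem_edgeFinset, SimpleGraph.mem_edgeSet] at this
  let r : Setoid ι :=
    { r := fun i j => H.Reachable (x i) (x j)
      iseqv := ⟨fun _ => SimpleGraph.Reachable.refl _, fun h => h.symm, fun h h' => h.trans h'⟩ }
  refine alternating_sum_eq_zero_of_noncrossing S r ?_ ?_ (fun j => spin t (x j)) ?_
  · intro a _ b _ c _ d _ hab hbc hcd
    exact hx H hHG a b c d hab hbc hcd
  · intro j _
    have hset : {i | i ∈ S ∧ r i j} = (({i ∈ S | H.Reachable (x i) (x j)} : Finset ι) : Set ι) := by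
      ext i
      simp only [Set.mem_ofPred_eq, Finset.coe_filter]
      rfl
    rw [hset, Set.ncard_coe_finset]
    -- Flipping one component of `η` changes no edge spin in `η`, so triviality of the character
    -- forces an even number of nodes of `S` on that component.
    let s : Spins V := fun v => if H.Reachable v (x j) then -1 else 1
    have hs : ∀ v, spin s v = if H.Reachable v (x j) then -1 else 1 := by
      intro v
      simp only [spin, s]
      split_ifs <;> simp
    have hedge : ∀ e ∈ η, edgeSpin s e = 1 := by
      intro e he
      induction e with
      | _ u v =>
        have huv : H.Reachable u v := by
          by_cases h : u = v
          · rw [h]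
          · exact SimpleGraph.Adj.reachable ((SimpleGraph.fromEdgeSet_adj _).2 ⟨he, h⟩)
        have : spin s u = spin s v := by
          rw [hs, hs]
          exact if_congr ⟨fun h => huv.symm.trans h, fun h => huv.trans h⟩ rfl rfl
        rw [edgeSpin_mk, this, spin_mul_self]
    have := hχ s
    rw [spinCharacter, Finset.prod_eq_one hedge, mul_one] at this
    simp_rw [hs] at this
    rw [Finset.prod_ite, Finset.prod_const, Finset.prod_const_one, mul_one] at this
    by_contra hodd
    rw [(Nat.not_even_iff_odd.1 hodd).neg_one_pow] at this
    norm_num at this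
  · intro i j hij
    have hij' : H.Reachable (x i) (x j) := hij
    generalize x i = u at hij'
    generalize x j = v at hij'
    rw [SimpleGraph.reachable_iff_reflTransGen] at hij'
    induction hij' with
    | refl => rfl
    | tail _ hbc ih =>
      rw [ih]
      have h1 := ht _ (Finset.mem_coe.1 ((SimpleGraph.fromEdgeSet_adj _).1 hbc).1)
      rw [edgeSpin_mk] at h1
      rename_i b c _
      linear_combination (spin t c) * h1 - (spin t b) * spin_mul_self t c

/-- Boundary spin correlations of the planar Ising model are Pfaffians. -/
theorem isPfaffianFunction_of_isNoncrossing (G : SimpleGraph V) [DecidableRel G.Adj] (J : Sym2 V → ℝ)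
    {ι : Type*} [LinearOrder ι] {x : ι → V} (hx : IsNoncrossing G x) :
    IsPfaffianFunction (fun u v => twoPoint G J 0 (x u) (x v))
      (fun S => isingExpect G J fun s => ∏ p ∈ S, spin s (x p)) := by
  refine ⟨by simp [isingExpect_one], fun S u hu => ?_⟩
  have huS : u ∉ S := fun h => lt_irrefl _ (hu u h)
  -- The factor `spin t (x u)` makes the term `j = u` the full correlation. In every other term it
  -- moves the spins at `u` and `j` from the first model to the second, and independence gives the
  -- product in the recursion.
  have h0 := expect_eq_zero G J x (insert u S) (g := fun t => spin t (x u) *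
    ∑ j ∈ insert u S, (-1 : ℝ) ^ ({i ∈ insert u S | i < j}.card) * spin t (x j))
    (fun t η hη ht hχ => by rw [alternating_sum_spin_eq_zero hx _ hη ht hχ, mul_zero])
  have hsum : ∀ s s' : Spins V, (∏ p ∈ insert u S, spin s (x p)) * (spin (s * s') (x u) *
      ∑ j ∈ insert u S, (-1 : ℝ) ^ ({i ∈ insert u S | i < j}.card) * spin (s * s') (x j)) =
      ∑ j ∈ insert u S, if j = u then (∏ p ∈ insert u S, spin s (x p)) * 1 else
        -(-1 : ℝ) ^ ({i ∈ S | i < j}.card) *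
          ((∏ p ∈ S.erase j, spin s (x p)) * (spin s' (x u) * spin s' (x j))) := by
    intro s s'
    rw [Finset.mul_sum, Finset.mul_sum]
    refine Finset.sum_congr rfl fun j hj => ?_
    split_ifs with hju
    · subst hju
      rw [Finset.filter_false_of_mem, Finset.card_empty, pow_zero]
      · linear_combination (∏ p ∈ insert j S, spin s (x p)) * spin_mul_self (s * s') (x j)
      · intro i hi
        rcases Finset.mem_insert.1 hi with rfl | hi
        · exact lt_irrefl _
        · exact (hu i hi).not_gt
    · have hjS : j ∈ S := (Finset.mem_insert.1 hj).resolve_left hju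
      rw [Finset.filter_insert, if_pos (hu j hjS), Finset.card_insert_of_notMem (by simp [huS]),
        Finset.prod_insert huS, ← Finset.mul_prod_erase S _ hjS, spin_mul, spin_mul, pow_succ]
      linear_combination (-(-1 : ℝ) ^ ({i ∈ S | i < j}.card) *
        (∏ p ∈ S.erase j, spin s (x p)) * (spin s' (x u) * spin s' (x j))) *
        (spin s (x j) * spin s (x j) * spin_mul_self s (x u) + spin_mul_self s (x j))
  simp_rw [hsum] at h0
  rw [expect_finset_sum, Finset.sum_insert huS] at h0
  simp only [if_true] at h0
  rw [expect_mul, isingExpect_one, mul_one, Finset.sum_congr rfl (g := fun j =>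
    -((-1) ^ ({i ∈ S | i < j}.card) * twoPoint G J 0 (x u) (x j) *
      isingExpect G J fun s => ∏ p ∈ S.erase j, spin s (x p))), Finset.sum_neg_distrib] at h0
  · simpa only using eq_of_sub_eq_zero h0
  · intro j hj
    have hju : j ≠ u := by rintro rfl; exact huS hj
    simp only [if_neg hju]
    rw [expect_const_mul, expect_mul, twoPoint_zero]
    ring

end Boundary

end AshkinTeller

/-! ### Nodes, colours and the correlation -/

namespace AshkinTeller

section BoundaryNodes

variable {V : Type*} {k : ℕ}

/-- Either the four boundary positions are strictly increasing and planarity applies, or two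
consecutive ones coincide and transitivity of reachability suffices. -/
theorem isNoncrossing_nodeVertex {G : SimpleGraph V} {Γ : PlaneEmbedding G} {w : Fin k → V}
    (hw : Γ.IsCounterclockwise w) : IsNoncrossing G (nodeVertex w) := by
  intro H hH a b c d hab hbc hcd hac hbd
  have hle : ∀ {p q : Fin k ×ₗ Fin 2}, p < q → (ofLex p).1 ≤ (ofLex q).1 := by
    intro p q h
    rcases Prod.Lex.lt_iff.1 h with h | h
    · exact h.le
    · exact h.1.le
  unfold nodeVertex at *
  rcases (hle hab).eq_or_lt with h1 | h1
  · rw [h1]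
  rcases (hle hbc).eq_or_lt with h2 | h2
  · rwa [h2]
  rcases (hle hcd).eq_or_lt with h3 | h3
  · rw [h3] at hac
    exact hac.trans hbd.symm
  exact hw.reachable_of_interlaced hH h1 h2 h3 hac hbd

variable [DecidableEq V]

theorem prod_nodes {w : Fin k → V} (hw : Function.Injective w) {T D : Finset V}
    (hrange : Set.range w = (T : Set V)) (hD : D ⊆ T) (f : V → ℝ) :
    ∏ p ∈ nodes w D, f (nodeVertex w p) = (∏ v ∈ T \ D, f v) * ∏ v ∈ D, f v ^ 2 := by
  have hT : T = Finset.univ.image w := by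
    rw [← Finset.coe_inj, ← hrange]; simp
  have h1 : ∏ p ∈ nodes w D, f (nodeVertex w p) =
      ∏ i : Fin k, f (w i) * (if w i ∈ D then f (w i) else 1) := by
    rw [nodes, Finset.prod_filter, ← Equiv.prod_comp toLex, Fintype.prod_prod_type]
    refine Finset.prod_congr rfl fun i _ => ?_
    simp [Fin.prod_univ_two, nodeVertex]
  rw [h1, ← Finset.prod_image (s := Finset.univ) (g := w)
    (f := fun v => f v * (if v ∈ D then f v else 1)) (fun i _ j _ h => hw h), ← hT,
    ← Finset.prod_sdiff hD]
  congr 1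
  · refine Finset.prod_congr rfl fun v hv => ?_
    rw [if_neg (Finset.mem_sdiff.1 hv).2, mul_one]
  · refine Finset.prod_congr rfl fun v hv => ?_
    rw [if_pos hv, sq]

theorem sources_union_sinks (w : Fin k → V) (D B : Finset V) :
    sources w D B ∪ sinks w D B = nodes w D := by
  ext p
  simp only [sources, sinks, Finset.mem_union, Finset.mem_filter]
  have := Nat.even_or_odd (nodeIndex (nodes w D) p)
  tauto

theorem disjoint_sources_sinks (w : Fin k → V) (D B : Finset V) :
    Disjoint (sources w D B) (sinks w D B) := by
  rw [Finset.disjoint_left]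
  intro p
  simp only [sources, sinks, Finset.mem_filter]
  have := Nat.not_even_iff_odd (n := nodeIndex (nodes w D) p)
  tauto

variable [Fintype V] (G : SimpleGraph V) [DecidableRel G.Adj] (J : Sym2 V → ℝ)

theorem boundaryDet_eq_signedDet (w : Fin k → V) (D B : Finset V)
    (h : (sources w D B).card = (sinks w D B).card) :
    boundaryDet G J 0 w D B h =
      signedDet (fun p q => twoPoint G J 0 (nodeVertex w p) (nodeVertex w q))
        (sources w D B) (sinks w D B) := by
  rw [signedDet_eq _ rfl h.symm]
  rfl

/-- The product of `φ` over the nodes that are not over `B` and of `φ̃` over those over `B`. -/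
theorem expect_prod_nodes_eq_splitSum {ι : Type*} [LinearOrder ι] (x : ι → V) (N : Finset ι)
    (B : Finset V) :
    expect G J 0 (fun s s' => ∏ p ∈ N, if x p ∈ B then phiTilde s s' (x p) else phi s s' (x p)) =
      (2 : ℝ)⁻¹ ^ N.card * splitSum (fun S => isingExpect G J fun s => ∏ p ∈ S, spin s (x p)) N
        (fun p => if x p ∈ B then -1 else 1) := by
  have h1 : ∀ s s' : Spins V,
      ∏ p ∈ N, (if x p ∈ B then phiTilde s s' (x p) else phi s s' (x p)) =
      ∑ S ∈ N.powerset, ((2 : ℝ)⁻¹ ^ N.card * ∏ p ∈ N \ S, (if x p ∈ B then -1 else 1 : ℝ)) *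
        ((∏ p ∈ S, spin s (x p)) * ∏ p ∈ N \ S, spin s' (x p)) := by
    intro s s'
    have : ∀ p, (if x p ∈ B then phiTilde s s' (x p) else phi s s' (x p)) =
        2⁻¹ * (spin s (x p) + (if x p ∈ B then -1 else 1 : ℝ) * spin s' (x p)) := by
      intro p
      unfold phi phiTilde
      split_ifs <;> ring
    simp_rw [this]
    rw [Finset.prod_mul_distrib, Finset.prod_const, Finset.prod_add, Finset.mul_sum]
    refine Finset.sum_congr rfl fun S _ => ?_
    rw [Finset.prod_mul_distrib]
    ring
  simp_rw [h1]
  rw [expect_finset_sum, splitSum, Finset.mul_sum]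
  refine Finset.sum_congr rfl fun S _ => ?_
  rw [expect_const_mul, expect_mul]
  ring

theorem phiCorrelation_eq_expect_prod_nodes {w : Fin k → V} (hw : Function.Injective w)
    {A₁ A₂ B₁ B₂ : Finset V} (hA : Disjoint A₁ A₂) (hB : Disjoint B₁ B₂)
    (hAB : Disjoint (A₁ ∪ A₂) (B₁ ∪ B₂))
    (hrange : Set.range w = ((A₁ ∪ A₂ ∪ (B₁ ∪ B₂) : Finset V) : Set V)) :
    phiCorrelation G J 0 A₁ A₂ B₁ B₂ = expect G J 0 (fun s s' => ∏ p ∈ nodes w (A₂ ∪ B₂),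
      if nodeVertex w p ∈ B₁ ∪ B₂ then phiTilde s s' (nodeVertex w p)
      else phi s s' (nodeVertex w p)) := by
  rw [phiCorrelation]
  congr 1
  funext s s'
  rw [prod_nodes hw hrange (f := fun v => if v ∈ B₁ ∪ B₂ then phiTilde s s' v else phi s s' v)]
  swap
  · intro v hv
    simp only [Finset.mem_union] at hv ⊢
    tauto
  rw [Finset.disjoint_union_left, Finset.disjoint_union_right, Finset.disjoint_union_right] at hAB
  obtain ⟨⟨h11, h12⟩, h21, h22⟩ := hAB
  have hsd : (A₁ ∪ A₂ ∪ (B₁ ∪ B₂)) \ (A₂ ∪ B₂) = A₁ ∪ B₁ := by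
    ext v
    have _ : v ∈ A₁ → v ∉ A₂ := fun h => Finset.disjoint_left.1 hA h
    have _ : v ∈ B₁ → v ∉ B₂ := fun h => Finset.disjoint_left.1 hB h
    have _ : v ∈ A₁ → v ∉ B₂ := fun h => Finset.disjoint_left.1 h12 h
    have _ : v ∈ A₂ → v ∉ B₁ := fun h => Finset.disjoint_left.1 h21 h
    simp only [Finset.mem_union, Finset.mem_sdiff]
    tauto
  have hred : ∀ {A : Finset V}, Disjoint A B₁ → Disjoint A B₂ → ∀ v ∈ A,
      (if v ∈ B₁ ∪ B₂ then phiTilde s s' v else phi s s' v) = phi s s' v := by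
    intro A h1 h2 v hv
    rw [if_neg]
    rw [Finset.mem_union]
    rintro (h | h)
    · exact Finset.disjoint_left.1 h1 hv h
    · exact Finset.disjoint_left.1 h2 hv h
  have hblue : ∀ v ∈ B₁ ∪ B₂,
      (if v ∈ B₁ ∪ B₂ then phiTilde s s' v else phi s s' v) = phiTilde s s' v :=
    fun v hv => if_pos hv
  rw [hsd, Finset.prod_union h11, Finset.prod_union h22,
    Finset.prod_congr rfl (hred h11 h12),
    Finset.prod_congr rfl fun v hv => hblue v (Finset.mem_union_left _ hv),
    Finset.prod_congr (s₁ := A₂) rfl fun v hv => congrArg (· ^ 2) (hred h21 h22 v hv),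
    Finset.prod_congr (s₁ := B₂) rfl fun v hv =>
      congrArg (· ^ 2) (hblue v (Finset.mem_union_right _ hv))]
  ring

/-- With colour sign `-1` for blue and `1` for red, a node is a source exactly when its colour sign
times the parity sign of its index is `1`. So the colour signs are the alternating twist of `δ = 1`
on sources and `δ = -1` on sinks. -/
theorem phiCorrelation_eq_signedDet {Γ : PlaneEmbedding G} {w : Fin k → V}
    (hw : Γ.IsCounterclockwise w) {A₁ A₂ B₁ B₂ : Finset V} (hA : Disjoint A₁ A₂)
    (hB : Disjoint B₁ B₂) (hAB : Disjoint (A₁ ∪ A₂) (B₁ ∪ B₂))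
    (hrange : Set.range w = ((A₁ ∪ A₂ ∪ (B₁ ∪ B₂) : Finset V) : Set V)) :
    phiCorrelation G J 0 A₁ A₂ B₁ B₂ = (2 : ℝ)⁻¹ ^ (nodes w (A₂ ∪ B₂)).card *
      (2 ^ (sources w (A₂ ∪ B₂) (B₁ ∪ B₂)).card *
        signedDet (fun p q => twoPoint G J 0 (nodeVertex w p) (nodeVertex w q))
          (sources w (A₂ ∪ B₂) (B₁ ∪ B₂)) (sinks w (A₂ ∪ B₂) (B₁ ∪ B₂))) := by
  have hpf := isPfaffianFunction_of_isNoncrossing G J (isNoncrossing_nodeVertex hw)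
  have hdisj := disjoint_sources_sinks w (A₂ ∪ B₂) (B₁ ∪ B₂)
  rw [phiCorrelation_eq_expect_prod_nodes G J hw.injective hA hB hAB hrange,
    expect_prod_nodes_eq_splitSum,
    ← hpf.alternatingSplitSum_eq_signedDet
      (fun p q => by simp only [twoPoint, mul_comm])
      (fun p => if p ∈ sources w (A₂ ∪ B₂) (B₁ ∪ B₂) then 1 else -1) _ _
      (fun p hp => if_pos hp) (fun p hp => if_neg (Finset.disjoint_right.1 hdisj hp)),
    sources_union_sinks, alternatingSplitSum]
  congr 1
  refine splitSum_congr _ fun p hp => ?_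
  have hidx : ({y ∈ nodes w (A₂ ∪ B₂) | y ≤ p}.card) = nodeIndex (nodes w (A₂ ∪ B₂)) p := rfl
  rw [hidx]
  have hsrc : p ∈ sources w (A₂ ∪ B₂) (B₁ ∪ B₂) ↔
      (Odd (nodeIndex (nodes w (A₂ ∪ B₂)) p) ∧ nodeVertex w p ∈ B₁ ∪ B₂) ∨
      (Even (nodeIndex (nodes w (A₂ ∪ B₂)) p) ∧ nodeVertex w p ∉ B₁ ∪ B₂) := by
    rw [sources, Finset.mem_filter, and_iff_right hp]
  simp only [hsrc]
  by_cases hb : nodeVertex w p ∈ B₁ ∪ B₂ <;>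
    rcases Nat.even_or_odd (nodeIndex (nodes w (A₂ ∪ B₂)) p) with he | ho
  · simp [hb, he, he.neg_one_pow, Nat.not_odd_iff_even.2 he]
  · simp [hb, ho, ho.neg_one_pow]
  · simp [hb, he, he.neg_one_pow]
  · simp [hb, ho, ho.neg_one_pow, Nat.not_even_iff_odd.2 ho]

/-- With `t = s * s'`, the fields are `spin s v` times `(1 ± spin t v) / 2 ≥ 0`. The spins of `s`
cancel in the squares, leaving a spin product over `A₁ ∪ B₁` times a nonnegative function of `t`. -/
theorem phiCorrelation_nonneg (hJ : ∀ e ∈ G.edgeFinset, 0 ≤ J e) {A₁ A₂ B₁ B₂ : Finset V}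
    (hAB : Disjoint (A₁ ∪ A₂) (B₁ ∪ B₂)) :
    0 ≤ phiCorrelation G J 0 A₁ A₂ B₁ B₂ := by
  have h11 : Disjoint A₁ B₁ :=
    hAB.mono Finset.subset_union_left Finset.subset_union_left
  have hphi : ∀ (s s' : Spins V) v, phi s s' v = spin s v * ((1 + spin (s * s') v) / 2) := by
    intro s s' v
    rw [phi, spin_mul]
    linear_combination (-spin s' v / 2) * spin_mul_self s v
  have hphiT : ∀ (s s' : Spins V) v,
      phiTilde s s' v = spin s v * ((1 - spin (s * s') v) / 2) := by
    intro s s' v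
    rw [phiTilde, spin_mul]
    linear_combination (spin s' v / 2) * spin_mul_self s v
  have hs1 : ∀ (t : Spins V) v, 0 ≤ (1 + spin t v) / 2 := by
    intro t v
    rcases eq_one_or_neg_one_of_mul_self (spin_mul_self t v) with h | h <;> rw [h] <;> norm_num
  have hs2 : ∀ (t : Spins V) v, 0 ≤ (1 - spin t v) / 2 := by
    intro t v
    rcases eq_one_or_neg_one_of_mul_self (spin_mul_self t v) with h | h <;> rw [h] <;> norm_num
  have hsq : ∀ (s : Spins V) (v : V) (a : ℝ), (spin s v * a) ^ 2 = a ^ 2 := by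
    intro s v a
    linear_combination a ^ 2 * spin_mul_self s v
  have key := expect_nonneg G J hJ (fun v => v) (A₁ ∪ B₁) (g := fun t =>
    (∏ v ∈ A₁, (1 + spin t v) / 2) * (∏ v ∈ A₂, ((1 + spin t v) / 2) ^ 2) *
      (∏ v ∈ B₁, (1 - spin t v) / 2) * (∏ v ∈ B₂, ((1 - spin t v) / 2) ^ 2)) fun t =>
    mul_nonneg (mul_nonneg (mul_nonneg (Finset.prod_nonneg fun v _ => hs1 t v)
      (Finset.prod_nonneg fun v _ => sq_nonneg _)) (Finset.prod_nonneg fun v _ => hs2 t v))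
      (Finset.prod_nonneg fun v _ => sq_nonneg _)
  refine key.trans_eq ?_
  rw [phiCorrelation]
  congr 1
  funext s s'
  simp only [hphi, hphiT, hsq, Finset.prod_mul_distrib, Finset.prod_union h11]
  ring

end BoundaryNodes

end AshkinTeller

end

theorem theorem1 {V : Type*} [Fintype V] [DecidableEq V] (G : SimpleGraph V) [DecidableRel G.Adj]
    (hG : G.Connected) (Γ : PlaneEmbedding G) (J : Sym2 V → ℝ)
    (A₁ A₂ B₁ B₂ : Finset V)
    (hA : Disjoint A₁ A₂) (hB : Disjoint B₁ B₂) (hAB : Disjoint (A₁ ∪ A₂) (B₁ ∪ B₂))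
    {k : ℕ} (w : Fin k → V) (hw : Γ.IsCounterclockwise w)
    (hrange : Set.range w = ((A₁ ∪ A₂ ∪ (B₁ ∪ B₂) : Finset V) : Set V)) :
    (∀ h : (AshkinTeller.sources w (A₂ ∪ B₂) (B₁ ∪ B₂)).card =
          (AshkinTeller.sinks w (A₂ ∪ B₂) (B₁ ∪ B₂)).card,
      AshkinTeller.phiCorrelation G J 0 A₁ A₂ B₁ B₂ =
          (2 : ℝ) ^ (-((AshkinTeller.nodes w (A₂ ∪ B₂)).card : ℝ) / 2) *
            AshkinTeller.boundaryDet G J 0 w (A₂ ∪ B₂) (B₁ ∪ B₂) h ∧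
      ((∀ e ∈ G.edgeSet, 0 ≤ J e) →
        0 ≤ AshkinTeller.boundaryDet G J 0 w (A₂ ∪ B₂) (B₁ ∪ B₂) h)) ∧
    ((AshkinTeller.sources w (A₂ ∪ B₂) (B₁ ∪ B₂)).card ≠
          (AshkinTeller.sinks w (A₂ ∪ B₂) (B₁ ∪ B₂)).card →
      AshkinTeller.phiCorrelation G J 0 A₁ A₂ B₁ B₂ = 0) := by
  have hcorr := AshkinTeller.phiCorrelation_eq_signedDet G J hw hA hB hAB hrange
  refine ⟨fun h => ?_, fun h => ?_⟩
  · have hcard : (AshkinTeller.nodes w (A₂ ∪ B₂)).card =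
        2 * (AshkinTeller.sources w (A₂ ∪ B₂) (B₁ ∪ B₂)).card := by
      rw [← AshkinTeller.sources_union_sinks w (A₂ ∪ B₂) (B₁ ∪ B₂),
        Finset.card_union_of_disjoint (AshkinTeller.disjoint_sources_sinks _ _ _), ← h, two_mul]
    -- Each node contributes `1/2` and each source-sink pair contributes `2`; in the balanced case
    -- half of the nodes are sources.
    have hpow : (2 : ℝ) ^ (-((AshkinTeller.nodes w (A₂ ∪ B₂)).card : ℝ) / 2) =
        2⁻¹ ^ (AshkinTeller.nodes w (A₂ ∪ B₂)).card *
          2 ^ (AshkinTeller.sources w (A₂ ∪ B₂) (B₁ ∪ B₂)).card := by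
      rw [hcard]
      generalize (AshkinTeller.sources w (A₂ ∪ B₂) (B₁ ∪ B₂)).card = n
      rw [show -(((2 * n : ℕ) : ℝ)) / 2 = -(n : ℝ) by push_cast; ring,
        Real.rpow_neg zero_le_two, Real.rpow_natCast, two_mul, pow_add, mul_assoc, ← mul_pow,
        inv_mul_cancel₀ two_ne_zero, one_pow, mul_one, inv_pow]
    rw [← mul_assoc, ← hpow, ← AshkinTeller.boundaryDet_eq_signedDet G J w _ _ h] at hcorr
    refine ⟨hcorr, fun hJ => ?_⟩
    have hnn := AshkinTeller.phiCorrelation_nonneg G J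
      (fun e he => hJ e (SimpleGraph.mem_edgeFinset.1 he)) hAB
    rw [hcorr] at hnn
    exact nonneg_of_mul_nonneg_right hnn (Real.rpow_pos_of_pos two_pos _)
  · rw [hcorr, signedDet, dif_neg h, mul_zero, mul_zero]
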